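/- **Setting.** For $\lambda\in\mathbb N$ let $q$ be a prime with $\lambda^5<q\le 2\lambda^5$, and let $s=\lambda$, $k=\lambda^3$, $\Sigma=\mathbb F_q^s$. Let $C_\lambda\subseteq\Sigma^q$ be the univariate multiplicity code with evaluation points $1,\dots,q$, i.e. the set of all words $\big((f^{(0)}(i),\dots,f^{(s-1)}(i))\big)_{i=1}^{q}$ with $f\in\mathbb F_q[X]$, $\deg f<k$, where $f^{(j)}$ is the $j$-th Hasse derivative. Let $C_\lambda^\perp$ be its dual with respect to $x\cdot z=\sum_{i=1}^q\sum_{j=1}^s (x_i)_j(z_i)_j$. For $H:[q]\times\Sigma\to\{0,1\}$ let $$R_{C_\lambda,H}=\{(\mathbf b,\mathbf v)\in\{0,1\}^q\times\Sigma^q:\ \mathbf v\in C_\lambda,\ H(i,v_i)=b_i\ \forall i\in[q]\},$$ and for $E\subseteq\{0,1\}^\lambda\times\Sigma^q$ let $O[H,E]:\{0,1\}^\lambda\times\Sigma^q\to\{0,1\}$ be the oracle with $O[H,E](x,\mathbf v)=1$ if and only if $(x\|0^{q-\lambda},\mathbf v)\in R_{C_\lambda,H}$ and $(x,\mathbf v)\in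 E$. *The set $\mathsf{Good}$.* Fix a unique decoder $\mathsf{Dec}:\Sigma^q\to\Sigma^q$ for $C_\lambda^\perp$: $\mathsf{Dec}(\mathbf u+\mathbf e)=\mathbf u$ whenever $\mathbf u\in C_\lambda^\perp$ and the Hamming weight of $\mathbf e$ is less than half the minimum distance of $C_\lambda^\perp$ (its values elsewhere are arbitrary). Let $S_{i,b}=\{e\in\Sigma: H(i,e)=b\}$. The biased Yamakawa–Zhandry algorithm on input $\mathbf b\in\{0,1\}^q$ fails if some $S_{i,b}$ (with $i\in[q]$, $b\in\{0,1\}$) is empty; otherwise it starts from the state $\bigotimes_{i=1}^q\big(|S_{i,b_i}|^{-1/2}\sum_{e\in S_{i,b_i}}|e\rangle\big)_{\mathsf A}\otimes\big(|C_\lambda|^{-1/2}\sum_{\mathbf u\in C_\lambda}|\mathbf u\rangle\big)_{\mathsf B}$ (taken from its advice state), applies the quantum Fourier transform $|\mathbf x\rangle\mapsto|\Sigma|^{-q/2}\sum_{\mathbf z\in\Sigma^q}e^{2\pi i(\mathbf x\cdot\mathbf z)/q}|\mathbf z\rangle$ to both registers, then $|\mathbf e,\mathbf u\rangle\mapsto|\mathbf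 e+\mathbf u,\mathbf u\rangle$, then $|\mathbf w,\mathbf u\rangle\mapsto|\mathbf w,\mathbf u-\mathsf{Dec}(\mathbf w)\rangle$, then the inverse Fourier transform to $\mathsf A$, and measures $\mathsf A$ to obtain the output $\mathbf v\in\Sigma^q$. Let $\mathsf{Good}$ be the set of all $H$ such that for every $x\in\{0,1\}^\lambda$, on input $\mathbf b=x\|0^{q-\lambda}$, the output satisfies $(\mathbf b,\mathbf v)\in R_{C_\lambda,H}$ with probability at least $2/3$. *Query algorithms.* A quantum query algorithm with a $t$-bit classical witness and $Q$ queries has a query register, an answer qubit, a $t$-qubit witness register and finitely many ancilla qubits. Started in a basis state that holds the witness $w\in\{0,1\}^t$, with all other registers in a fixed basis state, it applies arbitrary unitaries $V_0,\dots,V_Q$ on all registers, with one query gate $|x,\mathbf v\rangle|y\rangle\mapsto|x,\mathbf v\rangle|y\oplus O(x,\mathbf v)\rangle$ between consecutive unitaries, and accepts (outputs $1$) according to the outcome of a standard basis measurement. (The query register may have further basis states, on which the oracle answers $0$.) **Lemma.** Let $a>0$ be a constant and let $Q,t:\mathbb N\to\mathbb N$ satisfy $Q(\lambda)\le a\lambda^a$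 and $t(\lambda)\le a\lambda^a$ for all sufficiently large $\lambda$. Then for all sufficiently large $\lambda$, for every prime $q$ with $\lambda^5<q\le2\lambda^5$, every unique decoder $\mathsf{Dec}$ for $C_\lambda^\perp$, and every quantum query algorithm $\mathcal A$ that takes a classical witness of length $t(\lambda)$ and makes $Q(\lambda)$ queries to an oracle on $\{0,1\}^\lambda\times\Sigma^q$, there exist $H^*\in\mathsf{Good}$ and $E^*\subseteq\{0,1\}^\lambda\times\Sigma^q$ such that 1. either $E^*=\{0,1\}^\lambda\times\Sigma^q$, but for all witnesses $w\in\{0,1\}^{t(\lambda)}$, $\Pr[\mathcal A^{O[H^*,E^*]}(w)=1]<\tfrac23$; 2. or $E^*\subseteq F^*\times\Sigma^q$ for some $F^*\subseteq\{0,1\}^\lambda$ with $|F^*|\le 2^\lambda/3$, but there exists a witness $\tilde w\in\{0,1\}^{t(\lambda)}$ with $\Pr[\mathcal A^{O[H^*,E^*]}(\tilde w)=1]>\tfrac13$. -/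

import Mathlib

open Filter

noncomputable section

namespace CodeIntersection

/-! ### Codes over the alphabet `𝔽_q ^ s`, for a prime `q` -/

/-- The alphabet `Σ = 𝔽_q ^ s`. -/
abbrev Sym (q s : ℕ) : Type := Fin s → ZMod q

/-- The words `Σ ^ n`. -/
abbrev Word (q s n : ℕ) : Type := Fin n → Sym q s

/-- The bilinear form `∑ i, ∑ j, (x i) j * (z i) j` on `(𝔽_q ^ s) ^ n`. -/
def dot {q s n : ℕ} (x z : Word q s n) : ZMod q := ∑ i, ∑ j, x i j * z i j

/-- The dual of a code. -/
def dualCode {q s n : ℕ} (C : Set (Word q s n)) : Set (Word q s n) :=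
  {z | ∀ c ∈ C, dot z c = 0}

/-- Any two distinct codewords differ in at least `d` positions. -/
def HasDistance {q s n : ℕ} (C : Set (Word q s n)) (d : ℕ) : Prop :=
  ∀ c₁ ∈ C, ∀ c₂ ∈ C, c₁ ≠ c₂ → d ≤ hammingNorm (c₁ - c₂)

/-- `Dec` is a unique decoder for `C`: it corrects every error pattern whose Hamming weight is
smaller than half the distance of `C`. Nothing is asked of `Dec` on other inputs. -/
def IsUniqueDecoder {q s n : ℕ} (C : Set (Word q s n)) (Dec : Word q s n → Word q s n) : Prop :=
  ∀ d : ℕ, HasDistance C d → ∀ u ∈ C, ∀ e : Word q s n, 2 * hammingNorm e < d → Dec (u + e) = u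

/-- The univariate multiplicity code with evaluation points `α`, which encodes a polynomial `f` of
degree less than `k` by the values of its first `s` Hasse derivatives at the points `α i`. -/
def multCodeAt {q n : ℕ} (s : ℕ) (α : Fin n → ZMod q) (k : ℕ) : Set (Word q s n) :=
  {c | ∃ f ∈ Polynomial.degreeLT (ZMod q) k,
    ∀ i, ∀ j : Fin s, c i j = (Polynomial.hasseDeriv (j : ℕ) f).eval (α i)}

/-- The multiplicity code with evaluation points `1, …, q`. -/
def multCode (q s k : ℕ) : Set (Word q s q) :=
  multCodeAt s (fun i : Fin q => (((i : ℕ) + 1 : ℕ) : ZMod q)) k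

/-- The code `C_l` of the code intersection subset size problem of size `l`:
`s = l` and `k = l ^ 3`. -/
def code (l q : ℕ) : Set (Word q l q) := multCode q l (l ^ 3)

/-! ### The code intersection relation and the oracle -/

/-- The code intersection relation `R_{C,H}`. -/
def codeRel {q s n : ℕ} (C : Set (Word q s n)) (H : Fin n → Sym q s → Bool) :
    Set ((Fin n → Bool) × Word q s n) :=
  {p | p.2 ∈ C ∧ ∀ i, H i (p.2 i) = p.1 i}

/-- The string `x ‖ 0^(n - l)`. -/
def padZero {l : ℕ} (n : ℕ) (x : Fin l → Bool) : Fin n → Bool :=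
  fun i => if h : (i : ℕ) < l then x ⟨i, h⟩ else false

/-- The input domain `{0,1}^l × Σ^q` of the oracle. -/
abbrev OracleDomain (l q : ℕ) : Type := (Fin l → Bool) × Word q l q

open Classical in
/-- The oracle `O[H, E]`. -/
def oracle (l q : ℕ) (H : Fin q → Sym q l → Bool) (E : Set (OracleDomain l q)) :
    OracleDomain l q → Bool :=
  fun p => decide ((padZero q p.1, p.2) ∈ codeRel (code l q) H ∧ p ∈ E)

/-! ### The biased Yamakawa–Zhandry algorithm

States of a register with basis `Σ ^ n` are functions `Σ ^ n → ℂ`; states of two such registers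
`A`, `B` are functions `Σ ^ n → Σ ^ n → ℂ`, the first argument belonging to `A`. -/

section YZ

variable {q s n : ℕ} [Fact q.Prime]

/-- The quantum Fourier transform on `Σ ^ n`:
`|x⟩ ↦ |Σ|^(-n/2) ∑ z, exp (2πi (x · z) / q) |z⟩`. -/
def qft (ψ : Word q s n → ℂ) : Word q s n → ℂ :=
  fun z => ((Real.sqrt (Fintype.card (Word q s n)) : ℝ) : ℂ)⁻¹ *
    ∑ x, ZMod.stdAddChar (dot x z) * ψ x

/-- The inverse quantum Fourier transform on `Σ ^ n`. -/
def qftInv (ψ : Word q s n → ℂ) : Word q s n → ℂ :=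
  fun z => ((Real.sqrt (Fintype.card (Word q s n)) : ℝ) : ℂ)⁻¹ *
    ∑ x, ZMod.stdAddChar (-dot x z) * ψ x

/-- The set `S_{i,b}` of symbols which `H i` maps to `b`. -/
def preimages (H : Fin n → Sym q s → Bool) (i : Fin n) (b : Bool) : Finset (Sym q s) :=
  Finset.univ.filter fun e => H i e = b

/-- The state `|φ_{i,b}⟩`, the uniform superposition over `S_{i,b}` (used only when this set is
not empty). -/
def preimageState (H : Fin n → Sym q s → Bool) (i : Fin n) (b : Bool) : Sym q s → ℂ :=
  fun e => if H i e = b then ((Real.sqrt (preimages H i b).card : ℝ) : ℂ)⁻¹ else 0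

open Classical in
/-- The state `|ψ⟩`, the uniform superposition over the code. -/
def codeState (C : Set (Word q s n)) : Word q s n → ℂ :=
  fun u => if u ∈ C then ((Real.sqrt (Nat.card C) : ℝ) : ℂ)⁻¹ else 0

/-- Step 1: the part `(⨂ i, |φ_{i,b_i}⟩)_A ⊗ |ψ⟩_B` of the advice state that is selected by `b`. -/
def yzPrepare (C : Set (Word q s n)) (H : Fin n → Sym q s → Bool) (b : Fin n → Bool) :
    Word q s n → Word q s n → ℂ :=
  fun e u => (∏ i, preimageState H i (b i) (e i)) * codeState C u

/-- Step 2: apply the quantum Fourier transform to both registers. -/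
def yzFourier (Ψ : Word q s n → Word q s n → ℂ) : Word q s n → Word q s n → ℂ :=
  fun e u => qft (fun e' => qft (Ψ e') u) e

/-- Step 3: add the value of `B` to `A`, that is `|e, u⟩ ↦ |e + u, u⟩`. -/
def yzAdd (Ψ : Word q s n → Word q s n → ℂ) : Word q s n → Word q s n → ℂ :=
  fun w u => Ψ (w - u) u

/-- Step 4: uncompute `B` with the decoder, that is `|w, u⟩ ↦ |w, u - Dec w⟩`. -/
def yzDecode (Dec : Word q s n → Word q s n) (Ψ : Word q s n → Word q s n → ℂ) :
    Word q s n → Word q s n → ℂ :=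
  fun w u => Ψ w (u + Dec w)

/-- Step 5, before the measurement: apply the inverse quantum Fourier transform to `A`. -/
def yzUnfourier (Ψ : Word q s n → Word q s n → ℂ) : Word q s n → Word q s n → ℂ :=
  fun v u => qftInv (fun w => Ψ w u) v

/-- The state of the algorithm right before register `A` is measured. -/
def yzFinal (C : Set (Word q s n)) (Dec : Word q s n → Word q s n)
    (H : Fin n → Sym q s → Bool) (b : Fin n → Bool) : Word q s n → Word q s n → ℂ :=
  yzUnfourier (yzDecode Dec (yzAdd (yzFourier (yzPrepare C H b))))

open Classical in
/-- The probability that the algorithm, run with the advice state of `(C, H)` on input `b`, outputs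
some `v` with `(b, v) ∈ R_{C,H}`. If one of the sets `S_{i,b'}` is empty, the advice state is `|⊥⟩`
and the algorithm fails. -/
def yzSuccess (C : Set (Word q s n)) (Dec : Word q s n → Word q s n)
    (H : Fin n → Sym q s → Bool) (b : Fin n → Bool) : ℝ :=
  if ∀ i b', (preimages H i b').Nonempty then
    ∑ v, if (b, v) ∈ codeRel C H then ∑ u, ‖yzFinal C Dec H b v u‖ ^ 2 else 0
  else 0

end YZ

/-- The set `Good` of functions `H` for which the biased Yamakawa–Zhandry algorithm with decoder
`Dec` succeeds with probability at least `2/3` on every `x ∈ {0,1}^l`. -/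
def Good (l q : ℕ) [Fact q.Prime] (Dec : Word q l q → Word q l q) :
    Set (Fin q → Sym q l → Bool) :=
  {H | ∀ x : Fin l → Bool, 2 / 3 ≤ yzSuccess (code l q) Dec H (padZero q x)}

/-! ### Quantum query algorithms with a classical witness -/

/-- Computational basis of a query algorithm: query register, answer qubit, witness register of `t`
qubits, and `anc` ancilla qubits. Besides the elements of the oracle domain `D`, the query register
may have `pad` further basis states (say, bit strings which encode no element of `D`). -/
abbrev QBasis (D : Type) (t pad anc : ℕ) : Type :=
  (D ⊕ Fin pad) × Bool × (Fin t → Bool) × (Fin anc → Bool)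

/-- A quantum query algorithm with a `t`-bit classical witness that makes `Q` queries to an oracle
with domain `D`: arbitrary unitaries `unitary 0, …, unitary Q`, with a query gate between any two
consecutive ones, then a measurement in the standard basis whose outcome is accepted or not. -/
structure QueryAlgorithm (D : Type) [Fintype D] [DecidableEq D] (t Q : ℕ) where
  pad : ℕ
  anc : ℕ
  start : D ⊕ Fin pad
  unitary : Fin (Q + 1) → Matrix.unitaryGroup (QBasis D t pad anc) ℂ
  accept : QBasis D t pad anc → Bool

namespace QueryAlgorithm

variable {D : Type} [Fintype D] [DecidableEq D] {t Q : ℕ}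

/-- The query gate `|x, b⟩ ↦ |x, b ⊕ f x⟩`; the oracle answers `0` on the padding states. -/
def queryGate (f : D → Bool) {pad anc : ℕ} (ψ : QBasis D t pad anc → ℂ) :
    QBasis D t pad anc → ℂ :=
  fun z => ψ (z.1, xor z.2.1 (Sum.elim f (fun _ => false) z.1), z.2.2)

/-- The initial basis state: the classical witness `w`, all other qubits being `0`. -/
def initState (A : QueryAlgorithm D t Q) (w : Fin t → Bool) : QBasis D t A.pad A.anc → ℂ :=
  Pi.single (A.start, false, w, fun _ => false) 1

/-- The state right after the `i`-th unitary, that is, after `i` queries. -/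
def stateAt (A : QueryAlgorithm D t Q) (f : D → Bool) (w : Fin t → Bool) (i : Fin (Q + 1)) :
    QBasis D t A.pad A.anc → ℂ :=
  Fin.induction (motive := fun _ => QBasis D t A.pad A.anc → ℂ)
    ((A.unitary 0 : Matrix _ _ ℂ).mulVec (A.initState w))
    (fun j ψ => (A.unitary j.succ : Matrix _ _ ℂ).mulVec (queryGate f ψ)) i

/-- The probability that the algorithm accepts with oracle `f` and witness `w`. -/
def acceptProb (A : QueryAlgorithm D t Q) (f : D → Bool) (w : Fin t → Bool) : ℝ :=
  ∑ z, if A.accept z then ‖A.stateAt f w (Fin.last Q) z‖ ^ 2 else 0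

end QueryAlgorithm

end CodeIntersection

end

/-!
The proof is by contradiction and averages over random functions `H` whose values are independent
and equal to `true` with probability `ε = 1 / l ^ 4`.

*Most `H` are good* (`half_le_weight_good`). The error patterns of the Yamakawa–Zhandry algorithm
have weight at most `l` at the positions of `x`, where the required bit may be `1`, and about
`ε * q = O(l)` elsewhere. The dual code has distance at least `l ^ 2`, since the blocks of a
multiplicity code at fewer than `l ^ 2` points are independent
(`hasDistance_dualCode_multCodeAt`), so uncorrectable patterns have mass `2 ^ (-Ω(l ^ 2))`. They
harm the algorithm in two ways (`le_yzSuccess`): through their own part of the final state, and by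
missing from the part that the decoder treats correctly. The second effect is measured on the code
only, but by translation invariance of the distribution of `H` no word receives more than its
average share (`sum_weight_mul_badPart_mul_codeState`). Markov's inequality and a union bound over
the `2 ^ l` inputs conclude.

*A verifier yields valid pairs.* If the claim fails, some witness `w` is accepted with the full
oracle for a set of good `H` of probability at least `2 ^ (-t - 1)`. Let `E` be a set of pairs in
the relation for all `H` under consideration. With the oracle `O[H, E]`, which is then the indicator
function of `E` and does not depend on `H`, the verifier rejects. By the hybrid method
(`QueryAlgorithm.le_sum_queryMass_of_acceptProb`) this run queries, with weight `Ω(1 / Q)`, pairs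
outside `E` that are valid for `H`. So one new pair is valid for a fraction `Ω(1 / Q ^ 2)` of the
functions (`exists_valid_pair`), and one can restrict to these and repeat. After `K = 2 ^ (l - 2)`
steps there remains a set of functions of probability at least `O(Q ^ 2) ^ (-K) * 2 ^ (-t - 1)`, for
which `K` common pairs with different codewords are valid.

*Expansion* (`le_sum_card_image_of_subset_multCodeAt`). The `K` codewords involve `Ω(K * q)`
different pairs of a position and a symbol, at each of which the value of `H` is prescribed. Hence
the same set of functions has probability at most `(1 - ε) ^ Ω(K * q) = exp (-Ω(K * l))`, which is
a contradiction. The expansion is proved by interpolation: a nonzero multilinear polynomial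
`P(X, Y_0, …, Y_{m-1})` vanishes at all the symbols if these are too few, so that all the codewords
stem from solutions `f` of the differential equation `P(X, f, f', …, f^(m-1)) = 0`. Differentiating
`P` with respect to its last variable until the equation fails leads to an equation which `f` solves
and whose leading coefficient vanishes at few points; at all other points the symbol, as an initial
condition, determines `f`. So almost every codeword has a symbol of its own at almost every
position, and the symbols are many after all.
-/

noncomputable section

namespace CodeIntersection

/-! ### Expansion of multiplicity codes -/

section Expansion

open Polynomial

/-- The multilinear polynomial in the variables `y 0, …, y (m - 1)` with coefficients `c n`,
`n < 2 ^ m`, where `c n` belongs to the product of the `y i` over the binary digits `1` of `n`. -/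
def mlEval {R : Type*} [CommRing R] : ℕ → (ℕ → R) → (ℕ → R) → R
  | 0, c, _ => c 0
  | m + 1, c, y => mlEval m c y + y m * mlEval m (fun n => c (n + 2 ^ m)) y

section mlEval

variable {R S : Type*} [CommRing R] [CommRing S]

lemma map_mlEval (φ : R →+* S) (m : ℕ) (c y : ℕ → R) :
    φ (mlEval m c y) = mlEval m (fun n => φ (c n)) (fun n => φ (y n)) := by
  induction m generalizing c with
  | zero => rfl
  | succ m ih => simp only [mlEval, map_add, map_mul, ih]

lemma mlEval_add (m : ℕ) (c c' y : ℕ → R) :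
    mlEval m (fun n => c n + c' n) y = mlEval m c y + mlEval m c' y := by
  induction m generalizing c c' with
  | zero => rfl
  | succ m ih => simp only [mlEval, ih]; ring

lemma mlEval_smul (m : ℕ) (r : R) (c y : ℕ → R) :
    mlEval m (fun n => r * c n) y = r * mlEval m c y := by
  induction m generalizing c with
  | zero => rfl
  | succ m ih => simp only [mlEval, ih]; ring

lemma mlEval_congr (m : ℕ) {c c' y y' : ℕ → R} (hc : ∀ n < 2 ^ m, c n = c' n)
    (hy : ∀ i < m, y i = y' i) : mlEval m c y = mlEval m c' y' := by
  induction m generalizing c c' with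
  | zero => exact hc 0 (by simp)
  | succ m ih =>
    have h2 : 2 ^ (m + 1) = 2 ^ m + 2 ^ m := by ring
    simp only [mlEval]
    rw [ih (fun n hn => hc n (by omega)) fun i hi => hy i (by omega),
      ih (fun n hn => hc (n + 2 ^ m) (by omega)) fun i hi => hy i (by omega), hy m (by omega)]

lemma mlEval_eq_zero (m : ℕ) {c y : ℕ → R} (hc : ∀ n < 2 ^ m, c n = 0) : mlEval m c y = 0 := by
  have := mlEval_smul m 0 c y
  rw [zero_mul] at this
  rw [← this]
  exact mlEval_congr m (fun n hn => by rw [hc n hn, zero_mul]) fun _ _ => rfl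

lemma dvd_mlEval_sub (m : ℕ) {d : R} (c : ℕ → R) {y y' : ℕ → R} (h : ∀ i < m, d ∣ y i - y' i) :
    d ∣ mlEval m c y - mlEval m c y' := by
  induction m generalizing c with
  | zero => simp [mlEval]
  | succ m ih =>
    have h' : ∀ i < m, d ∣ y i - y' i := fun i hi => h i (by omega)
    have : mlEval (m + 1) c y - mlEval (m + 1) c y' = (mlEval m c y - mlEval m c y') +
        (y m * (mlEval m (fun n => c (n + 2 ^ m)) y - mlEval m (fun n => c (n + 2 ^ m)) y') +
          (y m - y' m) * mlEval m (fun n => c (n + 2 ^ m)) y') := by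
      simp only [mlEval]; ring
    rw [this]
    exact dvd_add (ih c h') (dvd_add ((ih _ h').mul_left _) ((h m (by omega)).mul_right _))

lemma natDegree_mlEval_le (m : ℕ) {c y : ℕ → R[X]} {a k : ℕ} (hc : ∀ n, (c n).natDegree ≤ a)
    (hy : ∀ i, (y i).natDegree ≤ k) : (mlEval m c y).natDegree ≤ a + k * m := by
  induction m generalizing c with
  | zero => simpa [mlEval] using hc 0
  | succ m ih =>
    refine (natDegree_add_le _ _).trans (max_le ((ih hc).trans (by gcongr; omega)) ?_)
    refine natDegree_mul_le.trans ((add_le_add (hy m) (ih fun n => hc _)).trans ?_)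
    rw [mul_add]; omega

end mlEval

section Pivot

variable {F : Type*} [Field F]

open Classical in
/-- For a multilinear polynomial `P = P₀ + Y_{m-1} P₁` with coefficients in `F[X]` consider the
chain which goes from `P` to `P₁` (the derivative with respect to the last variable), or to `P₀` if
`P₁ = 0`, until it ends at a coefficient. The pivot is the value at `y` of the first member of the
chain which does not vanish at `y`. -/
def mlPivot : ℕ → (ℕ → F[X]) → (ℕ → F[X]) → F[X]
  | 0, c, _ => c 0
  | m + 1, c, y =>
    if mlEval (m + 1) c y ≠ 0 then mlEval (m + 1) c y
    else if ∀ n < 2 ^ m, c (n + 2 ^ m) = 0 then mlPivot m c y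
    else mlPivot m (fun n => c (n + 2 ^ m)) y

lemma mlPivot_of_ne (m : ℕ) {c y : ℕ → F[X]} (h : mlEval m c y ≠ 0) :
    mlPivot m c y = mlEval m c y := by
  cases m with
  | zero => rfl
  | succ m => rw [mlPivot, if_pos h]

lemma mlPivot_ne_zero (m : ℕ) {c : ℕ → F[X]} (y : ℕ → F[X]) (hc : ∃ n < 2 ^ m, c n ≠ 0) :
    mlPivot m c y ≠ 0 := by
  induction m generalizing c with
  | zero =>
    obtain ⟨n, hn, h⟩ := hc
    obtain rfl : n = 0 := by simpa using hn
    exact h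
  | succ m ih =>
    rw [mlPivot]
    split_ifs with h1 h2
    · exact h1
    · obtain ⟨n, hn, h⟩ := hc
      refine ih ⟨n, ?_, h⟩
      by_contra hn'
      have h2' : 2 ^ (m + 1) = 2 ^ m + 2 ^ m := by ring
      refine h ?_
      have := h2 (n - 2 ^ m) (by omega)
      rwa [Nat.sub_add_cancel (by omega)] at this
    · push Not at h2
      exact ih h2

lemma natDegree_mlPivot_le (m : ℕ) {c y : ℕ → F[X]} {a k : ℕ} (hc : ∀ n, (c n).natDegree ≤ a)
    (hy : ∀ i, (y i).natDegree ≤ k) : (mlPivot m c y).natDegree ≤ a + k * m := by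
  induction m generalizing c with
  | zero => simpa [mlPivot] using hc 0
  | succ m ih =>
    have hk : a + k * m ≤ a + k * (m + 1) := by gcongr; omega
    rw [mlPivot]
    split_ifs with h1 h2
    · exact natDegree_mlEval_le _ hc hy
    · exact (ih hc).trans hk
    · exact (ih fun n => hc _).trans hk

lemma X_sub_C_pow_dvd_iff_hasseDeriv {p : F[X]} {α : F} {n : ℕ} :
    (X - C α) ^ n ∣ p ↔ ∀ j < n, (hasseDeriv j p).eval α = 0 := by
  have h : (X - C α) ^ n ∣ p ↔ X ^ n ∣ taylor α p := by
    have h1 : taylorEquiv α ((X - C α) ^ n) = X ^ n := by simp [taylorEquiv]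
    rw [← map_dvd_iff (taylorEquiv α), h1]
    rfl
  rw [h, X_pow_dvd_iff]
  simp only [taylor_coeff]

lemma eval_hasseDeriv_hasseDeriv (i j : ℕ) (p : F[X]) (α : F) :
    (hasseDeriv j (hasseDeriv i p)).eval α
      = ((i + j).choose i : F) * (hasseDeriv (i + j) p).eval α := by
  have h : hasseDeriv j (hasseDeriv i p) = (j + i).choose j • hasseDeriv (j + i) p :=
    congrArg (fun L => L p) (hasseDeriv_comp (R := F) j i)
  rw [h, add_comm j i, Nat.choose_symm_add, nsmul_eq_mul, eval_mul, eval_natCast]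

/-- A solution of the differential equation `P₀ + Y_j P₁ = 0` with `P₀`, `P₁` in the variables
`X, Y_0, …, Y_{j-1}` is determined by the values of its first `j + 1` Hasse derivatives at a point
where `P₁` does not vanish, if its degree is smaller than the characteristic. -/
lemma eq_of_mlEval_succ_eq_zero {k j : ℕ} (hk : ∀ r < k, ∀ i ≤ r, (r.choose i : F) ≠ 0) {α : F}
    (c : ℕ → F[X]) {f g : F[X]} (hf : f ∈ degreeLT F k) (hg : g ∈ degreeLT F k)
    (hPf : mlEval (j + 1) c (fun i => hasseDeriv i f) = 0)
    (hPg : mlEval (j + 1) c (fun i => hasseDeriv i g) = 0)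
    (hfg : ∀ i < j + 1, (hasseDeriv i f).eval α = (hasseDeriv i g).eval α)
    (hne : (mlEval j (fun n => c (n + 2 ^ j)) fun i => hasseDeriv i f).eval α ≠ 0) : f = g := by
  by_contra hfg'
  set h := f - g with hh
  have hh0 : h ≠ 0 := sub_ne_zero.mpr hfg'
  have hex : ∃ r, (hasseDeriv r h).eval α ≠ 0 := by
    by_contra hcon
    push Not at hcon
    exact hh0 (eq_zero_of_hasseDeriv_eq_zero h α hcon)
  classical
  set r := Nat.find hex with hr
  have hr0 : (hasseDeriv r h).eval α ≠ 0 := Nat.find_spec hex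
  have hrlt : ∀ i < r, (hasseDeriv i h).eval α = 0 := fun i hi => by
    simpa using Nat.find_min hex hi
  have hrj : j < r := by
    by_contra hcon
    refine hr0 ?_
    rw [hh, map_sub, eval_sub, hfg r (by omega), sub_self]
  have hrk : r < k := by
    by_contra hcon
    refine hr0 ?_
    have hdeg : h.degree < k := mem_degreeLT.mp (Submodule.sub_mem _ hf hg)
    have : h.natDegree < k := (natDegree_lt_iff_degree_lt hh0).mpr hdeg
    rw [hasseDeriv_eq_zero_of_lt_natDegree h r (by omega), eval_zero]
  -- The differences of the lower derivatives vanish at `α` to a higher order than that of the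
  -- `j`-th ones.
  have hdvd : ∀ i < j, (X - C α) ^ (r - j + 1) ∣ hasseDeriv i f - hasseDeriv i g := by
    intro i hi
    rw [← map_sub, ← hh, X_sub_C_pow_dvd_iff_hasseDeriv]
    intro l hl
    rw [eval_hasseDeriv_hasseDeriv, hrlt (i + l) (by omega), mul_zero]
  have key : (X - C α) ^ (r - j + 1) ∣
      (mlEval j (fun n => c (n + 2 ^ j)) fun i => hasseDeriv i f) * hasseDeriv j h := by
    have e : (mlEval j (fun n => c (n + 2 ^ j)) fun i => hasseDeriv i f) * hasseDeriv j h =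
        -((mlEval j c fun i => hasseDeriv i f) - (mlEval j c fun i => hasseDeriv i g)) -
        hasseDeriv j g * ((mlEval j (fun n => c (n + 2 ^ j)) fun i => hasseDeriv i f) -
          mlEval j (fun n => c (n + 2 ^ j)) fun i => hasseDeriv i g) := by
      simp only [mlEval] at hPf hPg
      rw [hh, map_sub]
      linear_combination hPf - hPg
    rw [e]
    exact dvd_sub ((dvd_mlEval_sub j c hdvd).neg_right) ((dvd_mlEval_sub j _ hdvd).mul_left _)
  have hcop : IsCoprime ((X - C α) ^ (r - j + 1))
      (mlEval j (fun n => c (n + 2 ^ j)) fun i => hasseDeriv i f) := by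
    refine IsCoprime.pow_left ?_
    rw [(irreducible_X_sub_C α).coprime_iff_not_dvd, dvd_iff_isRoot]
    exact hne
  have := X_sub_C_pow_dvd_iff_hasseDeriv.mp (hcop.dvd_of_dvd_mul_left key) (r - j) (by omega)
  rw [eval_hasseDeriv_hasseDeriv, Nat.add_sub_cancel' hrj.le] at this
  exact mul_ne_zero (hk r hrk j hrj.le) hr0 this

lemma eq_of_mlPivot_eval_ne_zero {k m : ℕ} (hk : ∀ r < k, ∀ i ≤ r, (r.choose i : F) ≠ 0) {α : F}
    (c : ℕ → F[X]) (hc : ∃ n < 2 ^ m, c n ≠ 0) {f g : F[X]}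
    (hf : f ∈ degreeLT F k) (hg : g ∈ degreeLT F k)
    (hPf : mlEval m c (fun i => hasseDeriv i f) = 0)
    (hPg : mlEval m c (fun i => hasseDeriv i g) = 0)
    (hfg : ∀ i < m, (hasseDeriv i f).eval α = (hasseDeriv i g).eval α)
    (hf' : (mlPivot m c fun i => hasseDeriv i f).eval α ≠ 0)
    (hg' : (mlPivot m c fun i => hasseDeriv i g).eval α ≠ 0) : f = g := by
  induction m generalizing c with
  | zero =>
    simp only [mlEval] at hPf
    simp [mlPivot, hPf] at hf'
  | succ m ih =>
    rw [mlPivot, if_neg (by simpa using hPf)] at hf'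
    rw [mlPivot, if_neg (by simpa using hPg)] at hg'
    have hfg0 : ∀ i < m, (hasseDeriv i f).eval α = (hasseDeriv i g).eval α :=
      fun i hi => hfg i (by omega)
    by_cases h1 : ∀ n < 2 ^ m, c (n + 2 ^ m) = 0
    · rw [if_pos h1] at hf' hg'
      refine ih c ?_ ?_ ?_ hfg0 hf' hg'
      · obtain ⟨n, hn, h⟩ := hc
        refine ⟨n, ?_, h⟩
        by_contra hn'
        have h2' : 2 ^ (m + 1) = 2 ^ m + 2 ^ m := by ring
        have := h1 (n - 2 ^ m) (by omega)
        rw [Nat.sub_add_cancel (by omega)] at this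
        exact h this
      · simpa [mlEval, mlEval_eq_zero m h1] using hPf
      · simpa [mlEval, mlEval_eq_zero m h1] using hPg
    · rw [if_neg h1] at hf' hg'
      push Not at h1
      -- The value of `P₁` at `α` is the same for `f` and `g`.
      have hval : (mlEval m (fun n => c (n + 2 ^ m)) fun i => hasseDeriv i f).eval α =
          (mlEval m (fun n => c (n + 2 ^ m)) fun i => hasseDeriv i g).eval α := by
        rw [← coe_evalRingHom, map_mlEval, map_mlEval]
        exact mlEval_congr m (fun _ _ => rfl) hfg0
      by_cases hPf1 : mlEval m (fun n => c (n + 2 ^ m)) (fun i => hasseDeriv i f) = 0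
      · by_cases hPg1 : mlEval m (fun n => c (n + 2 ^ m)) (fun i => hasseDeriv i g) = 0
        · exact ih _ h1 hPf1 hPg1 hfg0 hf' hg'
        · rw [mlPivot_of_ne m hPg1, ← hval, hPf1] at hg'
          simp at hg'
      · rw [mlPivot_of_ne m hPf1] at hf'
        exact eq_of_mlEval_succ_eq_zero hk c hf hg hPf hPg hfg hf'

end Pivot

lemma choose_cast_ne_zero {q : ℕ} [hq : Fact q.Prime] {r i : ℕ} (hr : r < q) (hi : i ≤ r) :
    (r.choose i : ZMod q) ≠ 0 := by
  rw [Ne, ZMod.natCast_eq_zero_iff]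
  intro h
  have h1 : q ∣ r.factorial := by
    rw [← Nat.choose_mul_factorial_mul_factorial hi, mul_assoc]
    exact h.mul_right _
  exact absurd ((hq.out.dvd_factorial).mp h1) (by omega)

/-- Interpolation: each of the points `(α i, y i)` imposes one linear condition on the `A * 2 ^ m`
coefficients of a multilinear polynomial of degree less than `A` in `X`. -/
lemma exists_mlEval_eq_zero {F ι : Type*} [Field F] [Fintype ι] (m A : ℕ)
    (α : ι → F) (y : ι → ℕ → F) (hcard : Fintype.card ι < A * 2 ^ m) :
    ∃ c : ℕ → F[X], (∃ n < 2 ^ m, c n ≠ 0) ∧ (∀ n, c n ∈ degreeLT F A) ∧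
      ∀ i, mlEval m (fun n => (c n).eval (α i)) (y i) = 0 := by
  classical
  let ext : (Fin (2 ^ m) → degreeLT F A) → ℕ → F[X] :=
    fun x n => if h : n < 2 ^ m then (x ⟨n, h⟩ : F[X]) else 0
  let T : (Fin (2 ^ m) → degreeLT F A) →ₗ[F] (ι → F) :=
    { toFun := fun x i => mlEval m (fun n => (ext x n).eval (α i)) (y i)
      map_add' := fun x x' => by
        funext i
        simp only [Pi.add_apply]
        rw [← mlEval_add]
        refine mlEval_congr m (fun n hn => ?_) fun _ _ => rfl
        simp [ext, hn]
      map_smul' := fun r x => by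
        funext i
        simp only [Pi.smul_apply, RingHom.id_apply, smul_eq_mul]
        rw [← mlEval_smul]
        refine mlEval_congr m (fun n hn => ?_) fun _ _ => rfl
        simp [ext, hn] }
  have hfin : Module.Finite F (degreeLT F A) := Module.Finite.equiv (degreeLTEquiv F A).symm
  have hrank : Module.finrank F (degreeLT F A) = A := by
    rw [(degreeLTEquiv F A).finrank_eq]; simp
  have hker : LinearMap.ker T ≠ ⊥ := by
    refine LinearMap.ker_ne_bot_of_finrank_lt ?_
    rw [Module.finrank_fintype_fun_eq_card, Module.finrank_pi_fintype]
    simpa [hrank, mul_comm] using hcard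
  obtain ⟨x, hx, hx0⟩ := Submodule.exists_mem_ne_zero_of_ne_bot hker
  refine ⟨ext x, ?_, ?_, fun i => congrFun (LinearMap.mem_ker.mp hx) i⟩
  · by_contra hcon
    push Not at hcon
    refine hx0 (funext fun n => Subtype.ext ?_)
    simpa [ext] using hcon n n.2
  · intro n
    by_cases h : n < 2 ^ m
    · simp [ext, h]
    · simp [ext, h]

/-- Expansion of multiplicity codes: `2 ^ m` codewords use on average at least `A` different
symbols each, where `A` may be almost half the length of the code. -/
theorem le_sum_card_image_of_subset_multCodeAt {q s n k m A : ℕ} [Fact q.Prime] {α : Fin n → ZMod q}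
    (hα : Function.Injective α) (hms : m ≤ s) (hkq : k ≤ q) (hA : 0 < A)
    (hn : 2 * A + k * m ≤ n) (V : Finset (Word q s n)) (hV : ↑V ⊆ multCodeAt s α k)
    (hcard : V.card = 2 ^ m) :
    A * 2 ^ m ≤ ∑ i, (V.image fun v => v i).card := by
  classical
  by_contra! hlt
  choose! f hf using fun v (hv : v ∈ (V : Set (Word q s n))) => hV hv
  have hfd : ∀ v ∈ V, f v ∈ degreeLT (ZMod q) k := fun v hv => (hf v hv).1
  have hfe : ∀ v ∈ V, ∀ i (j : Fin s), v i j = (hasseDeriv (j : ℕ) (f v)).eval (α i) :=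
    fun v hv => (hf v hv).2
  obtain ⟨c, hc0, hcA, hc⟩ := exists_mlEval_eq_zero
    (ι := Σ i : Fin n, (V.image fun v => v i : Finset (Sym q s))) m A (fun p => α p.1)
    (fun p j => if h : j < s then (p.2 : Sym q s) ⟨j, h⟩ else 0) (by
      rw [Fintype.card_sigma]
      simpa only [Fintype.card_coe] using hlt)
  have hcd : ∀ n, (c n).natDegree ≤ A - 1 := fun n => by
    by_cases h : c n = 0
    · simp [h]
    · have := (natDegree_lt_iff_degree_lt h).mpr (mem_degreeLT.mp (hcA n))
      omega
  have hfk : ∀ v ∈ V, ∀ i, (hasseDeriv i (f v)).natDegree ≤ k := fun v hv i => by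
    refine (natDegree_hasseDeriv_le _ _).trans ?_
    by_cases h : f v = 0
    · simp [h]
    · have := (natDegree_lt_iff_degree_lt h).mpr (mem_degreeLT.mp (hfd v hv))
      omega
  -- Every codeword solves the differential equation.
  have hsol : ∀ v ∈ V, mlEval m c (fun i => hasseDeriv i (f v)) = 0 := by
    intro v hv
    refine eq_zero_of_natDegree_lt_card_of_eval_eq_zero _ hα (fun i => ?_) ?_
    · rw [← coe_evalRingHom, map_mlEval]
      refine (mlEval_congr m (fun _ _ => rfl) fun j hj => ?_).trans
        (hc ⟨i, ⟨v i, Finset.mem_image_of_mem _ hv⟩⟩)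
      have hjs : j < s := by omega
      simp [hjs, hfe v hv]
    · have := natDegree_mlEval_le m hcd (hfk v hv)
      simp only [Fintype.card_fin]
      omega
  let P : Word q s n → (ZMod q)[X] := fun v => mlPivot m c fun i => hasseDeriv i (f v)
  have hP0 : ∀ v ∈ V, P v ≠ 0 := fun v _ => mlPivot_ne_zero m _ hc0
  -- At the points where the pivot does not vanish, the symbol determines the codeword.
  have hinj : ∀ i, (V.filter fun v => (P v).eval (α i) ≠ 0).card ≤
      (V.image fun v => v i).card := by
    intro i
    refine Finset.card_le_card_of_injOn (fun v => v i) ?_ ?_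
    · intro v hv
      simp only [Finset.coe_filter, Set.mem_ofPred_eq] at hv
      exact Finset.mem_coe.mpr (Finset.mem_image_of_mem _ hv.1)
    · intro v hv w hw hvw
      simp only [Finset.coe_filter, Set.mem_ofPred_eq] at hv hw
      have hfw : f v = f w := by
        refine eq_of_mlPivot_eval_ne_zero (α := α i) (fun r hr j hj =>
          choose_cast_ne_zero (hr.trans_le hkq) hj) c hc0 (hfd v hv.1) (hfd w hw.1)
          (hsol v hv.1) (hsol w hw.1) (fun j hj => ?_) hv.2 hw.2
        have := congrFun hvw ⟨j, by omega⟩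
        simpa only [hfe v hv.1, hfe w hw.1] using this
      funext i' j'
      rw [hfe v hv.1, hfe w hw.1, hfw]
  have hgood : ∀ v ∈ V, A ≤ (Finset.univ.filter fun i => (P v).eval (α i) ≠ 0).card := by
    intro v hv
    have h1 : (Finset.univ.filter fun i => (P v).eval (α i) = 0).card ≤ (P v).natDegree := by
      refine le_trans ?_ ((Multiset.toFinset_card_le _).trans (card_roots' (P v)))
      refine Finset.card_le_card_of_injOn α (fun i hi => ?_) hα.injOn
      simp only [Finset.coe_filter, Set.mem_ofPred_eq] at hi
      simpa [hP0 v hv] using hi.2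
    have h2 := natDegree_mlPivot_le m hcd (hfk v hv)
    have h3 := Finset.card_filter_add_card_filter_not (s := (Finset.univ : Finset (Fin n)))
      (fun i => (P v).eval (α i) = 0)
    simp only [Finset.card_univ, Fintype.card_fin] at h3
    change (P v).natDegree ≤ _ at h2
    change A ≤ (Finset.univ.filter fun i => ¬ (P v).eval (α i) = 0).card
    omega
  refine absurd hlt (not_lt.mpr ?_)
  calc A * 2 ^ m = ∑ v ∈ V, A := by rw [Finset.sum_const, hcard, smul_eq_mul, mul_comm]
    _ ≤ ∑ v ∈ V, (Finset.univ.filter fun i => (P v).eval (α i) ≠ 0).card :=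
      Finset.sum_le_sum hgood
    _ = ∑ i, (V.filter fun v => (P v).eval (α i) ≠ 0).card :=
      Finset.sum_card_bipartiteAbove_eq_sum_card_bipartiteBelow _
    _ ≤ _ := Finset.sum_le_sum fun i _ => hinj i

end Expansion

/-! ### Random functions with independent biased values -/

/-- The Bernoulli distribution with `Pr[true] = ε`. -/
def bern (ε : ℝ) (b : Bool) : ℝ := if b then ε else 1 - ε

lemma bern_nonneg {ε : ℝ} (h0 : 0 ≤ ε) (h1 : ε ≤ 1) (b : Bool) : 0 ≤ bern ε b := by
  cases b <;> simp [bern, h0, h1]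

lemma bern_le {ε : ℝ} (h1 : ε ≤ 1 / 2) (b : Bool) : bern ε b ≤ 1 - ε := by
  cases b
  · simp [bern]
  · simp only [bern, if_true]; linarith

lemma sum_bern (ε : ℝ) : ∑ b, bern ε b = 1 := by simp [bern]

section Weight

variable {ι σ : Type*} [Fintype ι] [Fintype σ]

/-- The probability of `H : ι → σ → Bool`, if its values are independent and Bernoulli
distributed. -/
def weight (ε : ℝ) (H : ι → σ → Bool) : ℝ := ∏ i, ∏ e, bern ε (H i e)

lemma weight_nonneg {ε : ℝ} (h0 : 0 ≤ ε) (h1 : ε ≤ 1) (H : ι → σ → Bool) : 0 ≤ weight ε H :=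
  Finset.prod_nonneg fun _ _ => Finset.prod_nonneg fun _ _ => bern_nonneg h0 h1 _

variable [DecidableEq ι] [DecidableEq σ]

lemma sum_pi_prod {κ α : Type*} [Fintype κ] [DecidableEq κ] [Fintype α]
    (g : κ → α → ℝ) : ∑ h : κ → α, ∏ e, g e (h e) = ∏ e, ∑ b, g e b := by
  rw [Finset.prod_univ_sum, Fintype.piFinset_univ]

lemma sum_weight_mul_prod (ε : ℝ) (g : ι → (σ → Bool) → ℝ) :
    ∑ H : ι → σ → Bool, weight ε H * ∏ i, g i (H i) =
      ∏ i, ∑ h : σ → Bool, (∏ e, bern ε (h e)) * g i h := by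
  simp only [weight, ← Finset.prod_mul_distrib]
  exact sum_pi_prod fun i (h : σ → Bool) => (∏ e, bern ε (h e)) * g i h

lemma sum_weight_mul_prod_prod (ε : ℝ) (g : ι → σ → Bool → ℝ) :
    ∑ H : ι → σ → Bool, weight ε H * ∏ i, ∏ e, g i e (H i e) =
      ∏ i, ∏ e, ∑ b, bern ε b * g i e b := by
  rw [sum_weight_mul_prod ε fun i h => ∏ e, g i e (h e)]
  simp only [← Finset.prod_mul_distrib]
  exact Finset.prod_congr rfl fun i _ => sum_pi_prod fun e b => bern ε b * g i e b

lemma sum_prod_bern (ε : ℝ) : ∑ h : σ → Bool, ∏ e, bern ε (h e) = 1 := by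
  rw [sum_pi_prod fun _ b => bern ε b]
  simp only [sum_bern, Finset.prod_const_one]

lemma sum_weight (ε : ℝ) : ∑ H : ι → σ → Bool, weight ε H = 1 := by
  simpa [sum_prod_bern] using sum_weight_mul_prod (ι := ι) (σ := σ) ε fun _ _ => 1

lemma sum_weight_le_prod_prod {ε : ℝ} (h0 : 0 ≤ ε) (h1 : ε ≤ 1) (𝓗 : Finset (ι → σ → Bool))
    (g : ι → σ → Bool → ℝ) (hg : ∀ i e b, 0 ≤ g i e b) (h𝓗 : ∀ H ∈ 𝓗, ∀ i e, g i e (H i e) = 1) :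
    ∑ H ∈ 𝓗, weight ε H ≤ ∏ p : ι × σ, ∑ b, bern ε b * g p.1 p.2 b := by
  rw [Fintype.prod_prod_type (fun p : ι × σ => ∑ b, bern ε b * g p.1 p.2 b),
    ← sum_weight_mul_prod_prod ε g]
  have h : ∑ H ∈ 𝓗, weight ε H = ∑ H ∈ 𝓗, weight ε H * ∏ i, ∏ e, g i e (H i e) :=
    Finset.sum_congr rfl fun H hH => by simp only [h𝓗 H hH, Finset.prod_const_one, mul_one]
  rw [h]
  exact Finset.sum_le_sum_of_subset_of_nonneg (Finset.subset_univ _) fun H _ _ =>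
    mul_nonneg (weight_nonneg h0 h1 H)
      (Finset.prod_nonneg fun i _ => Finset.prod_nonneg fun e _ => hg _ _ _)

/-- Prescribing the values on a set `T` has probability at most `(1 - ε) ^ |T|`. -/
lemma sum_weight_le_pow {ε : ℝ} (h0 : 0 ≤ ε) (h1 : ε ≤ 1 / 2) (T : Finset (ι × σ))
    (𝓗 : Finset (ι → σ → Bool)) (y : ι → σ → Bool)
    (h𝓗 : ∀ H ∈ 𝓗, ∀ p ∈ T, H p.1 p.2 = y p.1 p.2) :
    ∑ H ∈ 𝓗, weight ε H ≤ (1 - ε) ^ T.card := by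
  have hg : ∀ i e b, 0 ≤ (if (i, e) ∈ T then if b = y i e then 1 else 0 else 1 : ℝ) :=
    fun i e b => by split_ifs <;> norm_num
  refine (sum_weight_le_prod_prod h0 (by linarith) 𝓗
    (fun i e b => if (i, e) ∈ T then if b = y i e then 1 else 0 else 1) hg
    fun H hH i e => ?_).trans ?_
  · by_cases h : (i, e) ∈ T
    · simp only [h, if_true, h𝓗 H hH _ h]
    · simp only [h, if_false]
  · calc _ ≤ ∏ p : ι × σ, if p ∈ T then 1 - ε else 1 := by
          refine Finset.prod_le_prod (fun p _ => Finset.sum_nonneg fun b _ =>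
            mul_nonneg (bern_nonneg h0 (by linarith) b) (hg _ _ _)) fun p _ => ?_
          by_cases hp : p ∈ T
          · simp only [hp, if_true, mul_ite, mul_one, mul_zero, Finset.sum_ite_eq',
              Finset.mem_univ]
            exact bern_le h1 _
          · simp [hp, bern]
      _ = (1 - ε) ^ T.card := by
          rw [Finset.prod_ite_mem, Finset.univ_inter, Finset.prod_const]

/-- The distribution is invariant under translations of the arguments. -/
lemma sum_weight_comp_add [AddGroup σ] (ε : ℝ) (G : (ι → σ → Bool) → ℝ) (v : ι → σ) :
    ∑ H, weight ε H * G (fun i e => H i (e + v i)) = ∑ H, weight ε H * G H := by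
  refine Fintype.sum_equiv
    (Equiv.piCongrRight fun i => (Equiv.addRight (-v i)).arrowCongr (Equiv.refl Bool)) _ _
    fun H => ?_
  have e : (Equiv.piCongrRight fun i => (Equiv.addRight (-v i)).arrowCongr (Equiv.refl Bool)) H =
      fun i e => H i (e + v i) := by
    funext i e
    simp [Equiv.arrowCongr]
  rw [e]
  congr 1
  exact Finset.prod_congr rfl fun i _ =>
    (Fintype.prod_equiv (Equiv.addRight (v i)) _ _ fun e => rfl).symm

/-- The expected number of points with value `b`. -/
lemma sum_prod_bern_mul_card (ε : ℝ) (b : Bool) :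
    ∑ h : σ → Bool, (∏ e, bern ε (h e)) * ((Finset.univ.filter fun e => h e = b).card : ℝ) =
      Fintype.card σ * bern ε b := by
  have h1 : ∀ e : σ, ∑ h : σ → Bool, (∏ e', bern ε (h e')) * (if h e = b then 1 else 0) =
      bern ε b := by
    intro e
    have h2 : ∀ h : σ → Bool, (∏ e', bern ε (h e')) * (if h e = b then 1 else 0) =
        ∏ e', bern ε (h e') * (if e' = e then if h e' = b then 1 else 0 else 1) := by
      intro h
      rw [Finset.prod_mul_distrib]
      simp
    simp only [h2]
    rw [sum_pi_prod fun e' b' => bern ε b' * (if e' = e then if b' = b then 1 else 0 else 1)]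
    rw [Finset.prod_eq_single e]
    · simp
    · intro e' _ he'
      simp only [he', if_false, mul_one]
      exact sum_bern ε
    · simp
  simp only [Finset.card_filter, Nat.cast_sum, Nat.cast_ite, Nat.cast_one, Nat.cast_zero,
    Finset.mul_sum]
  rw [Finset.sum_comm, Finset.sum_congr rfl fun e _ => h1 e]
  simp

end Weight

/-! ### Fourier analysis on words -/

section Fourier

variable {q : ℕ} [hq : Fact q.Prime]

lemma conj_stdAddChar (a : ZMod q) :
    (starRingEnd ℂ) (ZMod.stdAddChar a) = ZMod.stdAddChar (-a) := by
  rw [ZMod.stdAddChar_apply, ZMod.stdAddChar_apply, AddChar.map_neg_eq_inv,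
    Circle.coe_inv_eq_conj]

lemma sum_stdAddChar_hom {G : Type*} [AddCommGroup G] [Fintype G] (B : G →+ ZMod q)
    [Decidable (B = 0)] :
    ∑ x, ZMod.stdAddChar (B x) = if B = 0 then (Fintype.card G : ℂ) else 0 := by
  classical
  have h := AddChar.sum_eq_ite ((ZMod.stdAddChar (N := q)).compAddMonoidHom B)
  have h0 : (ZMod.stdAddChar (N := q)).compAddMonoidHom B = 0 ↔ B = 0 := by
    constructor
    · intro h
      ext x
      have hx := DFunLike.congr_fun h x
      refine ZMod.injective_stdAddChar ?_
      simpa using hx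
    · rintro rfl
      ext x
      simp
  simp only [h0, AddChar.compAddMonoidHom_apply] at h
  rw [h]

section Pairing

variable {G : Type*} [AddCommGroup G] [Fintype G]

/-- The Fourier transform on `G` with respect to the pairing `B`. -/
def pairFT (B : G →+ G →+ ZMod q) (ψ : G → ℂ) : G → ℂ :=
  fun z => ((Real.sqrt (Fintype.card G) : ℝ) : ℂ)⁻¹ * ∑ x, ZMod.stdAddChar (B x z) * ψ x

lemma inv_sqrt_card_mul_self :
    ((Real.sqrt (Fintype.card G) : ℝ) : ℂ)⁻¹ * ((Real.sqrt (Fintype.card G) : ℝ) : ℂ)⁻¹ =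
      (Fintype.card G : ℂ)⁻¹ := by
  rw [← mul_inv, ← Complex.ofReal_mul, Real.mul_self_sqrt (by positivity)]
  simp

lemma card_ne_zero' : (Fintype.card G : ℂ) ≠ 0 := Nat.cast_ne_zero.mpr Fintype.card_ne_zero

lemma sum_norm_sq_pairFT (B : G →+ G →+ ZMod q) (hB : Function.Injective B) (ψ : G → ℂ) :
    ∑ z, ‖pairFT B ψ z‖ ^ 2 = ∑ x, ‖ψ x‖ ^ 2 := by
  classical
  have h : ∀ z, ((‖pairFT B ψ z‖ ^ 2 : ℝ) : ℂ) = (Fintype.card G : ℂ)⁻¹ *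
      ∑ x, ∑ y, ψ x * (starRingEnd ℂ) (ψ y) * ZMod.stdAddChar (B (x - y) z) := by
    intro z
    rw [Complex.ofReal_pow, ← Complex.mul_conj', pairFT, map_mul, map_inv₀, Complex.conj_ofReal,
      mul_mul_mul_comm, inv_sqrt_card_mul_self, map_sum, Finset.sum_mul_sum]
    congr 1
    refine Finset.sum_congr rfl fun x _ => Finset.sum_congr rfl fun y _ => ?_
    rw [map_mul, conj_stdAddChar, map_sub, AddMonoidHom.sub_apply, sub_eq_add_neg,
      AddChar.map_add_eq_mul]
    ring
  rw [← Complex.ofReal_inj, Complex.ofReal_sum, Finset.sum_congr rfl fun z _ => h z,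
    ← Finset.mul_sum, Finset.sum_comm, Complex.ofReal_sum, Finset.mul_sum]
  refine Finset.sum_congr rfl fun x _ => ?_
  rw [Finset.sum_comm, Finset.sum_eq_single x]
  · rw [← Finset.mul_sum, sum_stdAddChar_hom (B (x - x)), sub_self, map_zero, if_pos rfl,
      Complex.mul_conj']
    have := card_ne_zero' (G := G)
    field_simp
    simp
  · intro y _ hy
    rw [← Finset.mul_sum, sum_stdAddChar_hom (B (x - y)), if_neg, mul_zero]
    rw [map_eq_zero_iff B hB, sub_eq_zero]
    exact hy.symm
  · simp

lemma pairFT_neg_pairFT (B : G →+ G →+ ZMod q) (hB : Function.Injective B)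
    (hsymm : ∀ x y, B x y = B y x) (ψ : G → ℂ) : pairFT (-B) (pairFT B ψ) = ψ := by
  classical
  funext z
  have h : ∀ x, ZMod.stdAddChar ((-B) x z) * pairFT B ψ x = ((Real.sqrt (Fintype.card G) : ℝ) : ℂ)⁻¹
      * ∑ y, ψ y * ZMod.stdAddChar (B (y - z) x) := by
    intro x
    rw [pairFT, mul_left_comm, Finset.mul_sum]
    congr 1
    refine Finset.sum_congr rfl fun y _ => ?_
    rw [map_sub, AddMonoidHom.sub_apply, sub_eq_add_neg, AddChar.map_add_eq_mul, hsymm z x]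
    simp only [AddMonoidHom.neg_apply]
    ring
  rw [pairFT, Finset.sum_congr rfl fun x _ => h x, ← Finset.mul_sum, ← mul_assoc,
    inv_sqrt_card_mul_self, Finset.sum_comm, Finset.sum_eq_single z]
  · rw [← Finset.mul_sum, sum_stdAddChar_hom (B (z - z)), sub_self, map_zero, if_pos rfl]
    have := card_ne_zero' (G := G)
    field_simp
  · intro y _ hy
    rw [← Finset.mul_sum, sum_stdAddChar_hom (B (y - z)), if_neg, mul_zero]
    rwa [map_eq_zero_iff B hB, sub_eq_zero]
  · simp

end Pairing

variable {s n : ℕ}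

/-- The form `dot` as a biadditive map. -/
def dotHom : Word q s n →+ Word q s n →+ ZMod q :=
  AddMonoidHom.mk' (fun x => AddMonoidHom.mk' (fun z => dot x z) fun z z' => by
    simp [dot, mul_add, Finset.sum_add_distrib]) fun x x' => by
    ext z
    simp [dot, add_mul, Finset.sum_add_distrib]

/-- The standard bilinear form on the alphabet as a biadditive map. -/
def symDotHom : Sym q s →+ Sym q s →+ ZMod q :=
  AddMonoidHom.mk' (fun x => AddMonoidHom.mk' (fun z => ∑ j, x j * z j) fun z z' => by
    simp [mul_add, Finset.sum_add_distrib]) fun x x' => by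
    ext z
    simp [add_mul, Finset.sum_add_distrib]

lemma dotHom_apply (x z : Word q s n) : dotHom x z = dot x z := rfl

lemma symDotHom_apply (x z : Sym q s) : symDotHom x z = ∑ j, x j * z j := rfl

lemma dot_comm {q s n : ℕ} (x z : Word q s n) : dot x z = dot z x := by simp only [dot, mul_comm]

lemma symDotHom_injective : Function.Injective (symDotHom : Sym q s →+ Sym q s →+ ZMod q) := by
  rw [injective_iff_map_eq_zero]
  intro x hx
  funext j
  simpa [symDotHom_apply, Pi.single_apply] using DFunLike.congr_fun hx (Pi.single j 1)

lemma dotHom_injective : Function.Injective (dotHom : Word q s n →+ Word q s n →+ ZMod q) := by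
  rw [injective_iff_map_eq_zero]
  intro x hx
  funext i j
  have := DFunLike.congr_fun hx (Pi.single i (Pi.single j 1))
  rw [dotHom_apply, dot, Finset.sum_eq_single i] at this
  · simpa [Pi.single_apply] using this
  · intro i' _ hi'
    simp [Pi.single_eq_of_ne hi']
  · simp

lemma qft_eq_pairFT (ψ : Word q s n → ℂ) : qft ψ = pairFT dotHom ψ := rfl

lemma qftInv_eq_pairFT (ψ : Word q s n → ℂ) : qftInv ψ = pairFT (-dotHom) ψ := rfl

lemma neg_dotHom_injective :
    Function.Injective (-dotHom : Word q s n →+ Word q s n →+ ZMod q) := by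
  intro x y h
  exact dotHom_injective (neg_injective h)

lemma sum_norm_sq_qft (ψ : Word q s n → ℂ) : ∑ z, ‖qft ψ z‖ ^ 2 = ∑ x, ‖ψ x‖ ^ 2 := by
  rw [qft_eq_pairFT]
  exact sum_norm_sq_pairFT _ dotHom_injective ψ

lemma sum_norm_sq_qftInv (ψ : Word q s n → ℂ) : ∑ z, ‖qftInv ψ z‖ ^ 2 = ∑ x, ‖ψ x‖ ^ 2 := by
  rw [qftInv_eq_pairFT]
  exact sum_norm_sq_pairFT _ neg_dotHom_injective ψ

lemma qftInv_qft (ψ : Word q s n → ℂ) : qftInv (qft ψ) = ψ := by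
  rw [qftInv_eq_pairFT, qft_eq_pairFT]
  exact pairFT_neg_pairFT _ dotHom_injective dot_comm ψ

lemma dot_add_left (x y z : Word q s n) : dot (x + y) z = dot x z + dot y z :=
  DFunLike.congr_fun (map_add dotHom x y) z

lemma dot_sub_left (x y z : Word q s n) : dot (x - y) z = dot x z - dot y z :=
  DFunLike.congr_fun (map_sub dotHom x y) z

lemma dot_add_right (x y z : Word q s n) : dot x (y + z) = dot x y + dot x z :=
  map_add (dotHom x) y z

lemma qftInv_add (ψ φ : Word q s n → ℂ) (v : Word q s n) :
    qftInv (fun w => ψ w + φ w) v = qftInv ψ v + qftInv φ v := by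
  simp only [qftInv, mul_add, Finset.sum_add_distrib]

lemma qftInv_conv (g h : Word q s n → ℂ) (v : Word q s n) :
    qftInv (fun w => ∑ u, g (w - u) * h u) v =
      ((Real.sqrt (Fintype.card (Word q s n)) : ℝ) : ℂ) * (qftInv g v * qftInv h v) := by
  set c := ((Real.sqrt (Fintype.card (Word q s n)) : ℝ) : ℂ) with hc
  have hc0 : c ≠ 0 := by
    rw [hc, Ne, Complex.ofReal_eq_zero, Real.sqrt_eq_zero (by positivity)]
    exact_mod_cast Fintype.card_ne_zero
  have h1 : ∑ w, ZMod.stdAddChar (-dot w v) * ∑ u, g (w - u) * h u =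
      (∑ w, ZMod.stdAddChar (-dot w v) * g w) * ∑ u, ZMod.stdAddChar (-dot u v) * h u := by
    simp only [Finset.mul_sum]
    rw [Finset.sum_comm]
    refine Finset.sum_congr rfl fun u _ => ?_
    rw [Finset.sum_mul]
    refine (Fintype.sum_equiv (Equiv.addRight u) _ _ fun w => ?_).symm
    simp only [Equiv.coe_addRight, add_sub_cancel_right]
    rw [dot_add_left, neg_add, AddChar.map_add_eq_mul]
    ring
  simp only [qftInv]
  rw [h1, ← hc]
  field_simp

/-- A translation of the argument becomes a phase under the Fourier transform. -/
lemma qft_comp_add (φ : Word q s n → ℂ) (v z : Word q s n) :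
    qft (fun e => φ (e + v)) z = ZMod.stdAddChar (-dot v z) * qft φ z := by
  simp only [qft]
  rw [mul_left_comm]
  congr 1
  rw [Finset.mul_sum]
  refine Fintype.sum_equiv (Equiv.addRight v) _ _ fun e => ?_
  simp only [Equiv.coe_addRight]
  rw [dot_add_left, AddChar.map_add_eq_mul, AddChar.map_neg_eq_inv]
  have : (ZMod.stdAddChar (dot v z) : ℂ) ≠ 0 := by
    rw [ZMod.stdAddChar_apply]
    exact Circle.coe_ne_zero _
  field_simp

lemma qftInv_phase (g : Word q s n → ℂ) (v z : Word q s n) :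
    qftInv (fun w => ZMod.stdAddChar (-dot v w) * g w) z = qftInv g (z + v) := by
  simp only [qftInv]
  congr 1
  refine Finset.sum_congr rfl fun w _ => ?_
  rw [dot_add_right, neg_add, AddChar.map_add_eq_mul, dot_comm w v]
  ring

lemma qft_prod (φ : Fin n → Sym q s → ℂ) (z : Word q s n) :
    qft (fun e => ∏ i, φ i (e i)) z = ∏ i, pairFT symDotHom (φ i) (z i) := by
  have hsqrt : ((Real.sqrt (Fintype.card (Word q s n)) : ℝ) : ℂ)⁻¹ =
      ∏ _i : Fin n, ((Real.sqrt (Fintype.card (Sym q s)) : ℝ) : ℂ)⁻¹ := by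
    have h : Real.sqrt (Fintype.card (Word q s n)) = Real.sqrt (Fintype.card (Sym q s)) ^ n := by
      rw [Real.sqrt_eq_iff_mul_self_eq (by positivity) (by positivity), ← mul_pow,
        Real.mul_self_sqrt (by positivity), Fintype.card_fun, Fintype.card_fin, Nat.cast_pow]
    rw [Finset.prod_const, Finset.card_univ, Fintype.card_fin, h, Complex.ofReal_pow, inv_pow]
  simp only [pairFT]
  rw [Finset.prod_mul_distrib, qft, hsqrt, Finset.prod_univ_sum, Fintype.piFinset_univ]
  congr 1
  refine Finset.sum_congr rfl fun e _ => ?_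
  rw [Finset.prod_mul_distrib]
  congr 1
  simp only [dot, symDotHom_apply]
  induction (Finset.univ : Finset (Fin n)) using Finset.induction_on with
  | empty => simp
  | insert i t hi ih => rw [Finset.sum_insert hi, Finset.prod_insert hi, AddChar.map_add_eq_mul, ih]

end Fourier

/-! ### The success probability of the Yamakawa–Zhandry algorithm -/

section YZAnalysis

variable {q s n : ℕ} [hq : Fact q.Prime]

/-- The state `⨂ i, |φ_{i,b_i}⟩`. -/
def preimageProd (H : Fin n → Sym q s → Bool) (b : Fin n → Bool) : Word q s n → ℂ :=
  fun e => ∏ i, preimageState H i (b i) (e i)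

/-- The part of `ψ` whose Fourier transform lives on the error patterns of weight at least `d / 2`,
which a unique decoder of a code of distance `d` may fail to correct. -/
def badPart (d : ℕ) (ψ : Word q s n → ℂ) : Word q s n → ℂ :=
  qftInv fun e => if 2 * hammingNorm e < d then 0 else qft ψ e

lemma sum_norm_sq_preimageState_eq (H : Fin n → Sym q s → Bool) (i : Fin n) (b : Bool) :
    ∑ e, ‖preimageState H i b e‖ ^ 2 =
      (preimages H i b).card * ((preimages H i b).card : ℝ)⁻¹ := by
  have h : ∀ e, ‖preimageState H i b e‖ ^ 2 =
      if H i e = b then ((preimages H i b).card : ℝ)⁻¹ else 0 := by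
    intro e
    simp only [preimageState]
    split_ifs
    · rw [norm_inv, Complex.norm_real, Real.norm_of_nonneg (by positivity), inv_pow,
        Real.sq_sqrt (by positivity)]
    · simp
  simp only [h]
  rw [← Finset.sum_filter, Finset.sum_const, nsmul_eq_mul]
  rfl

/-- This holds without a nonemptiness assumption, since the state of an empty set is zero. -/
lemma sum_norm_sq_preimageState_le (H : Fin n → Sym q s → Bool) (i : Fin n) (b : Bool) :
    ∑ e, ‖preimageState H i b e‖ ^ 2 ≤ 1 := by
  rw [sum_norm_sq_preimageState_eq]
  exact mul_inv_le_one

lemma sum_norm_sq_preimageState {H : Fin n → Sym q s → Bool} {i : Fin n} {b : Bool}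
    (hne : (preimages H i b).Nonempty) : ∑ e, ‖preimageState H i b e‖ ^ 2 = 1 := by
  rw [sum_norm_sq_preimageState_eq]
  exact mul_inv_cancel₀ (Nat.cast_ne_zero.mpr hne.card_ne_zero)

lemma sum_norm_sq_preimageProd {H : Fin n → Sym q s → Bool} {b : Fin n → Bool}
    (hne : ∀ i b', (preimages H i b').Nonempty) : ∑ e, ‖preimageProd H b e‖ ^ 2 = 1 := by
  simp only [preimageProd, norm_prod, ← Finset.prod_pow]
  rw [sum_pi_prod fun i e => ‖preimageState H i (b i) e‖ ^ 2]
  exact Finset.prod_eq_one fun i _ => sum_norm_sq_preimageState (hne i _)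

lemma sum_norm_sq_codeState (C : AddSubgroup (Word q s n)) :
    ∑ u, ‖codeState (C : Set (Word q s n)) u‖ ^ 2 = 1 := by
  classical
  have h : ∀ u, ‖codeState (C : Set (Word q s n)) u‖ ^ 2 =
      if u ∈ C then ((Nat.card C : ℝ))⁻¹ else 0 := by
    intro u
    simp only [codeState, SetLike.mem_coe]
    split_ifs
    · rw [norm_inv, Complex.norm_real, Real.norm_of_nonneg (by positivity), inv_pow,
        Real.sq_sqrt (by positivity)]
      rfl
    · simp
  simp only [h]
  rw [← Finset.sum_filter, Finset.sum_const, nsmul_eq_mul, ← Fintype.card_subtype,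
    Nat.card_eq_fintype_card]
  exact mul_inv_cancel₀ (Nat.cast_ne_zero.mpr Fintype.card_ne_zero)

lemma qft_codeState_eq_zero (C : AddSubgroup (Word q s n)) {z : Word q s n}
    (hz : z ∉ dualCode (C : Set (Word q s n))) :
    qft (codeState (C : Set (Word q s n))) z = 0 := by
  classical
  have hB : (dotHom z).comp C.subtype ≠ 0 := by
    intro h
    refine hz fun c hc => ?_
    exact DFunLike.congr_fun h ⟨c, hc⟩
  have hsum := sum_stdAddChar_hom ((dotHom z).comp C.subtype)
  rw [if_neg hB] at hsum
  simp only [qft, codeState, SetLike.mem_coe, mul_ite, mul_zero]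
  rw [← Finset.sum_filter, ← Finset.sum_mul,
    Finset.sum_subtype (p := fun x => x ∈ C) _ (by simp)]
  have h : ∑ x : C, ZMod.stdAddChar (dot (x : Word q s n) z) = 0 := by
    rw [← hsum]
    exact Finset.sum_congr rfl fun x _ => by rw [dot_comm]; rfl
  rw [h]
  simp

lemma yzFinal_apply (C : Set (Word q s n)) (Dec : Word q s n → Word q s n)
    (H : Fin n → Sym q s → Bool) (b : Fin n → Bool) (v u : Word q s n) :
    yzFinal C Dec H b v u = qftInv (fun w =>
      qft (preimageProd H b) (w - (u + Dec w)) * qft (codeState C) (u + Dec w)) v := by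
  have h : ∀ e u', yzFourier (yzPrepare C H b) e u' =
      qft (preimageProd H b) e * qft (codeState C) u' := by
    intro e u'
    have h1 : ∀ e', qft (yzPrepare C H b e') u' = preimageProd H b e' * qft (codeState C) u' := by
      intro e'
      simp only [qft, yzPrepare, preimageProd, Finset.mul_sum]
      exact Finset.sum_congr rfl fun x _ => by ring
    simp only [yzFourier, h1]
    generalize qft (codeState C) u' = a
    simp only [qft, Finset.mul_sum, Finset.sum_mul]
    exact Finset.sum_congr rfl fun x _ => by ring
  simp only [yzFinal, yzUnfourier, yzDecode, yzAdd, h]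

/-- Adding `B` to `A`, the uncomputation of `B` and the inverse Fourier transform preserve the
norm. -/
lemma sum_norm_sq_qftInv_decode (Dec : Word q s n → Word q s n) (g h : Word q s n → ℂ) :
    ∑ v, ∑ u, ‖qftInv (fun w => g (w - (u + Dec w)) * h (u + Dec w)) v‖ ^ 2 =
      (∑ e, ‖g e‖ ^ 2) * ∑ u, ‖h u‖ ^ 2 := by
  rw [Finset.sum_comm]
  simp only [sum_norm_sq_qftInv, norm_mul, mul_pow]
  rw [Finset.sum_comm]
  have h1 : ∀ w, ∑ u, ‖g (w - (u + Dec w))‖ ^ 2 * ‖h (u + Dec w)‖ ^ 2 =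
      ∑ u, ‖g (w - u)‖ ^ 2 * ‖h u‖ ^ 2 := fun w =>
    Fintype.sum_equiv (Equiv.addRight (Dec w)) _ _ fun u => rfl
  simp only [h1]
  rw [Finset.sum_comm, Finset.mul_sum]
  refine Finset.sum_congr rfl fun u _ => ?_
  rw [← Finset.sum_mul]
  congr 1
  exact Fintype.sum_equiv (Equiv.subRight u) _ _ fun w => rfl

/-- On correctable error patterns the decoder uncomputes the register `B`, and the inverse Fourier
transform turns the convolution into a product. -/
lemma qftInv_decode_of_correctable {C : AddSubgroup (Word q s n)} {Dec : Word q s n → Word q s n}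
    {d : ℕ} (hd : HasDistance (dualCode (C : Set (Word q s n))) d)
    (hDec : IsUniqueDecoder (dualCode (C : Set (Word q s n))) Dec) {g : Word q s n → ℂ}
    (hg : ∀ e, ¬ 2 * hammingNorm e < d → g e = 0) (v u : Word q s n) :
    qftInv (fun w => g (w - (u + Dec w)) * qft (codeState (C : Set (Word q s n))) (u + Dec w)) v =
      if u = 0 then ((Real.sqrt (Fintype.card (Word q s n)) : ℝ) : ℂ) *
        (qftInv g v * codeState (C : Set (Word q s n)) v) else 0 := by
  have key : ∀ w u', Dec w ≠ u' →
      g (w - u') * qft (codeState (C : Set (Word q s n))) u' = 0 := by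
    intro w u' hne
    by_cases hu : u' ∈ dualCode (C : Set (Word q s n))
    · by_cases he : 2 * hammingNorm (w - u') < d
      · refine absurd ?_ hne
        have := hDec d hd u' hu (w - u') he
        rwa [add_sub_cancel] at this
      · rw [hg _ he, zero_mul]
    · rw [qft_codeState_eq_zero C hu, mul_zero]
  split_ifs with hu
  · subst hu
    have h := qftInv_conv g (qft (codeState (C : Set (Word q s n)))) v
    rw [qftInv_qft] at h
    rw [← h]
    congr 1
    funext w
    rw [zero_add, Finset.sum_eq_single (Dec w)]
    · exact fun u' _ hu' => key w u' hu'.symm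
    · simp
  · have h0 : ∀ w, g (w - (u + Dec w)) * qft (codeState (C : Set (Word q s n))) (u + Dec w) = 0 :=
      fun w => key w _ (by simpa using fun h => hu h)
    simp [qftInv, h0]

/-- The success probability, bounded through the two effects of the uncorrectable error patterns:
their own contribution to the final state, and the distortion of the part that stems from the
correctable ones. -/
theorem le_yzSuccess {C : AddSubgroup (Word q s n)} {Dec : Word q s n → Word q s n} {d : ℕ}
    (hd : HasDistance (dualCode (C : Set (Word q s n))) d)
    (hDec : IsUniqueDecoder (dualCode (C : Set (Word q s n))) Dec)
    {H : Fin n → Sym q s → Bool} (b : Fin n → Bool)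
    (hne : ∀ i b', (preimages H i b').Nonempty) :
    1 - 2 * (∑ v, ‖badPart d (preimageProd H b) v‖ ^ 2 +
      ∑ v, Fintype.card (Word q s n) * ‖badPart d (preimageProd H b) v‖ ^ 2 *
        ‖codeState (C : Set (Word q s n)) v‖ ^ 2) ≤ yzSuccess C Dec H b := by
  classical
  set φ := preimageProd H b with hφ
  set ψ := codeState (C : Set (Word q s n)) with hψ
  set β := badPart d φ with hβ
  set N : ℝ := (Fintype.card (Word q s n) : ℝ) with hN
  let g : Word q s n → ℂ := fun e => if 2 * hammingNorm e < d then qft φ e else 0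
  let h : Word q s n → ℂ := fun e => if 2 * hammingNorm e < d then 0 else qft φ e
  let Z : Word q s n → Word q s n → ℂ := fun v u =>
    qftInv (fun w => h (w - (u + Dec w)) * qft ψ (u + Dec w)) v
  have hgh : ∀ e, qft φ e = g e + h e := fun e => by
    simp only [g, h]; split_ifs <;> simp
  have hβh : β = qftInv h := rfl
  have hgφ : ∀ v, qftInv g v = φ v - β v := by
    intro v
    have h1 := qftInv_add g h v
    simp only [← hgh] at h1
    rw [eq_sub_iff_add_eq, hβh, ← h1]
    exact congrFun (qftInv_qft φ) v
  have hfinal : ∀ v u, yzFinal C Dec H b v u =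
      (if u = 0 then ((Real.sqrt N : ℝ) : ℂ) * ((φ v - β v) * ψ v) else 0) + Z v u := by
    intro v u
    rw [yzFinal_apply, ← hgφ, hN, ← qftInv_decode_of_correctable hd hDec
      (fun e he => by simp only [g, if_neg he]) v u]
    have h1 := qftInv_add (fun w => g (w - (u + Dec w)) * qft ψ (u + Dec w))
      (fun w => h (w - (u + Dec w)) * qft ψ (u + Dec w)) v
    simp only [← add_mul, ← hgh] at h1
    exact h1
  have hZ : ∑ v, ∑ u, ‖Z v u‖ ^ 2 = ∑ v, ‖β v‖ ^ 2 := by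
    rw [sum_norm_sq_qftInv_decode Dec h, sum_norm_sq_qft, sum_norm_sq_codeState, mul_one, hβh,
      sum_norm_sq_qftInv]
  have htotal : ∑ v, ∑ u, ‖yzFinal C Dec H b v u‖ ^ 2 = 1 := by
    simp only [yzFinal_apply]
    rw [sum_norm_sq_qftInv_decode Dec, sum_norm_sq_qft, sum_norm_sq_qft, sum_norm_sq_codeState,
      sum_norm_sq_preimageProd hne, mul_one]
  have hbad : ∀ v, (b, v) ∉ codeRel (C : Set (Word q s n)) H →
      ∑ u, ‖yzFinal C Dec H b v u‖ ^ 2 ≤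
        2 * ∑ u, ‖Z v u‖ ^ 2 + 2 * (N * ‖β v‖ ^ 2 * ‖ψ v‖ ^ 2) := by
    intro v hv
    have h0 : φ v * ψ v = 0 := by
      by_contra hcon
      refine hv ⟨?_, fun i => ?_⟩
      · by_contra hvC
        exact hcon (by rw [hψ, codeState, if_neg hvC, mul_zero])
      · by_contra hi
        refine hcon (mul_eq_zero_of_left ?_ _)
        exact Finset.prod_eq_zero (Finset.mem_univ i) (by rw [preimageState, if_neg hi])
    have h1 : ∀ u, ‖yzFinal C Dec H b v u‖ ^ 2 ≤
        2 * ‖Z v u‖ ^ 2 + if u = 0 then 2 * (N * ‖β v‖ ^ 2 * ‖ψ v‖ ^ 2) else 0 := by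
      intro u
      rw [hfinal, sub_mul, h0, zero_sub]
      have hsq : ∀ x y : ℂ, ‖x + y‖ ^ 2 ≤ 2 * ‖y‖ ^ 2 + 2 * ‖x‖ ^ 2 := fun x y => by
        nlinarith [norm_add_le x y, norm_nonneg (x + y), sq_nonneg (‖x‖ - ‖y‖), norm_nonneg x,
          norm_nonneg y]
      refine (hsq _ _).trans (le_of_eq ?_)
      split_ifs
      · rw [norm_mul, norm_neg, norm_mul, Complex.norm_real, Real.norm_of_nonneg (by positivity),
          mul_pow, mul_pow, Real.sq_sqrt (by positivity)]
        ring
      · simp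
    refine (Finset.sum_le_sum fun u _ => h1 u).trans (le_of_eq ?_)
    rw [Finset.sum_add_distrib, Finset.mul_sum]
    simp
  rw [yzSuccess, if_pos hne]
  have hsplit : ∀ v, (∑ u, ‖yzFinal C Dec H b v u‖ ^ 2) ≤
      (if (b, v) ∈ codeRel (C : Set (Word q s n)) H then ∑ u, ‖yzFinal C Dec H b v u‖ ^ 2 else 0) +
        (2 * ∑ u, ‖Z v u‖ ^ 2 + 2 * (N * ‖β v‖ ^ 2 * ‖ψ v‖ ^ 2)) := by
    intro v
    split_ifs with hv
    · have : 0 ≤ 2 * ∑ u, ‖Z v u‖ ^ 2 + 2 * (N * ‖β v‖ ^ 2 * ‖ψ v‖ ^ 2) := by positivity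
      linarith
    · rw [zero_add]
      exact hbad v hv
  have := Finset.sum_le_sum fun v (_ : v ∈ Finset.univ) => hsplit v
  rw [htotal, Finset.sum_add_distrib, Finset.sum_add_distrib, ← Finset.mul_sum, ← Finset.mul_sum,
    hZ] at this
  linarith

end YZAnalysis

/-! ### Most functions are good -/

section Average

variable {q s n : ℕ} [hq : Fact q.Prime]

/-- A Chernoff-type bound: an uncorrectable error pattern `e` has `2 ^ d ≤ 4 ^ wt e`, and the
`4 ^ wt e`-weighted mass of all patterns factors over the positions. The amplitude of `0` at
position `i` is the square root of the density of the set `S_{i,b_i}`. -/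
lemma sum_norm_sq_badPart_le (d : ℕ) (H : Fin n → Sym q s → Bool) (b : Fin n → Bool) :
    ∑ v, ‖badPart d (preimageProd H b) v‖ ^ 2 ≤
      ((2 : ℝ) ^ d)⁻¹ *
        ∏ i, (4 - 3 * ((preimages H i (b i)).card / Fintype.card (Sym q s) : ℝ)) := by
  have hprod : ∀ e, qft (preimageProd H b) e =
      ∏ i, pairFT symDotHom (preimageState H i (b i)) (e i) := fun e => qft_prod _ e
  have h1 : ∀ e, ‖(if 2 * hammingNorm e < d then 0 else qft (preimageProd H b) e)‖ ^ 2 ≤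
      ((2 : ℝ) ^ d)⁻¹ * ∏ i, (if e i = 0 then 1 else 4) *
        ‖pairFT symDotHom (preimageState H i (b i)) (e i)‖ ^ 2 := by
    intro e
    rw [Finset.prod_mul_distrib, Finset.prod_pow, ← norm_prod, ← hprod]
    have hw : ∏ i, (if e i = 0 then (1 : ℝ) else 4) = 2 ^ (2 * hammingNorm e) := by
      rw [pow_mul, hammingNorm, Finset.card_filter, ← Finset.prod_pow_eq_pow_sum]
      refine Finset.prod_congr rfl fun i _ => ?_
      by_cases h : e i = 0
      · simp [h]
      · simp only [h, if_false, ne_eq, not_false_iff, if_true]; norm_num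
    rw [hw]
    split_ifs with h
    · rw [norm_zero, zero_pow two_ne_zero]; positivity
    · rw [← mul_assoc]
      refine le_mul_of_one_le_left (by positivity) ?_
      rw [inv_mul_eq_div, one_le_div (by positivity)]
      exact pow_le_pow_right₀ (by norm_num) (by omega)
  rw [badPart, sum_norm_sq_qftInv]
  refine (Finset.sum_le_sum fun e _ => h1 e).trans ?_
  rw [← Finset.mul_sum, sum_pi_prod fun i σ => (if σ = 0 then (1 : ℝ) else 4) *
        ‖pairFT symDotHom (preimageState H i (b i)) σ‖ ^ 2]
  refine mul_le_mul_of_nonneg_left (Finset.prod_le_prod (fun i _ => Finset.sum_nonneg fun σ _ => ?_)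
    fun i _ => ?_) (by positivity)
  · split_ifs <;> positivity
  · have h2 : ∀ σ : Sym q s, (if σ = 0 then (1 : ℝ) else 4) *
        ‖pairFT symDotHom (preimageState H i (b i)) σ‖ ^ 2 =
        4 * ‖pairFT symDotHom (preimageState H i (b i)) σ‖ ^ 2 -
          if σ = 0 then 3 * ‖pairFT symDotHom (preimageState H i (b i)) σ‖ ^ 2 else 0 := by
      intro σ; split_ifs <;> ring
    have h3 : ‖pairFT symDotHom (preimageState H i (b i)) (0 : Sym q s)‖ ^ 2 =
        ((preimages H i (b i)).card / Fintype.card (Sym q s) : ℝ) := by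
      have h4 : ∑ x : Sym q s, ZMod.stdAddChar (symDotHom x 0) * preimageState H i (b i) x =
          ((Real.sqrt (preimages H i (b i)).card : ℝ) : ℂ) := by
        simp only [map_zero, AddChar.map_zero_eq_one, one_mul, preimageState]
        rw [← Finset.sum_filter, Finset.sum_const, nsmul_eq_mul, ← Complex.ofReal_natCast,
          ← Complex.ofReal_inv, ← Complex.ofReal_mul, Complex.ofReal_inj]
        exact Real.div_sqrt
      rw [pairFT, h4, norm_mul, norm_inv, Complex.norm_real, Complex.norm_real,
        Real.norm_of_nonneg (by positivity), Real.norm_of_nonneg (by positivity), mul_pow, inv_pow,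
        Real.sq_sqrt (by positivity), Real.sq_sqrt (by positivity), inv_mul_eq_div]
    simp only [h2]
    rw [Finset.sum_sub_distrib, ← Finset.mul_sum, sum_norm_sq_pairFT _ symDotHom_injective,
      Finset.sum_ite_eq' Finset.univ (0 : Sym q s), if_pos (Finset.mem_univ _), h3]
    linarith [sum_norm_sq_preimageState_le H i (b i)]

lemma sum_weight_mul_badPart_le {ε : ℝ} (h0 : 0 ≤ ε) (h1 : ε ≤ 1) (d : ℕ) (b : Fin n → Bool) :
    ∑ H : Fin n → Sym q s → Bool, weight ε H * ∑ v, ‖badPart d (preimageProd H b) v‖ ^ 2 ≤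
      ((2 : ℝ) ^ d)⁻¹ * ∏ i, (4 - 3 * bern ε (b i)) := by
  have hS : (Fintype.card (Sym q s) : ℝ) ≠ 0 := Nat.cast_ne_zero.mpr Fintype.card_ne_zero
  calc _ ≤ ∑ H : Fin n → Sym q s → Bool, ((2 : ℝ) ^ d)⁻¹ * (weight ε H *
        ∏ i, (4 - 3 * ((Finset.univ.filter fun e => H i e = b i).card /
          Fintype.card (Sym q s) : ℝ))) := by
        refine Finset.sum_le_sum fun H _ => ?_
        rw [mul_left_comm]
        exact mul_le_mul_of_nonneg_left (sum_norm_sq_badPart_le d H b) (weight_nonneg h0 h1 H)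
    _ = ((2 : ℝ) ^ d)⁻¹ * ∏ i, (4 - 3 * bern ε (b i)) := by
        rw [← Finset.mul_sum, sum_weight_mul_prod ε fun i (h : Sym q s → Bool) =>
          (4 - 3 * ((Finset.univ.filter fun e => h e = b i).card / Fintype.card (Sym q s) : ℝ))]
        congr 1
        refine Finset.prod_congr rfl fun i _ => ?_
        have h2 : ∀ h : Sym q s → Bool, (∏ e, bern ε (h e)) *
            (4 - 3 * ((Finset.univ.filter fun e => h e = b i).card / Fintype.card (Sym q s) : ℝ)) =
            4 * (∏ e, bern ε (h e)) - 3 / Fintype.card (Sym q s) *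
              ((∏ e, bern ε (h e)) * ((Finset.univ.filter fun e => h e = b i).card : ℝ)) :=
          fun h => by ring
        simp only [h2]
        rw [Finset.sum_sub_distrib, ← Finset.mul_sum, ← Finset.mul_sum, sum_prod_bern,
          sum_prod_bern_mul_card]
        field_simp

lemma preimageProd_comp_add (H : Fin n → Sym q s → Bool) (b : Fin n → Bool) (v : Word q s n) :
    preimageProd (fun i e => H i (e + v i)) b = fun e => preimageProd H b (e + v) := by
  funext e
  refine Finset.prod_congr rfl fun i _ => ?_
  have hcard : (preimages (fun i e => H i (e + v i)) i (b i)).card =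
      (preimages H i (b i)).card := by
    refine Finset.card_bij (fun e _ => e + v i) ?_ ?_ ?_
    · intro e he
      simpa [preimages] using he
    · intro e _ e' _ h
      exact add_right_cancel h
    · intro e he
      refine ⟨e - v i, ?_, sub_add_cancel _ _⟩
      simpa [preimages] using he
  simp only [preimageState, hcard, Pi.add_apply]

lemma badPart_comp_add (d : ℕ) (φ : Word q s n → ℂ) (v z : Word q s n) :
    badPart d (fun e => φ (e + v)) z = badPart d φ (z + v) := by
  rw [badPart, badPart, ← qftInv_phase]
  congr 1
  funext e
  rw [qft_comp_add, mul_ite, mul_zero]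

/-- By translation invariance the average of `‖badPart‖ ^ 2` is the same at all words, so that the
code has no larger share of it than any other set of its size. -/
lemma sum_weight_mul_badPart_mul_codeState (ε : ℝ) (d : ℕ) (b : Fin n → Bool)
    (C : AddSubgroup (Word q s n)) :
    ∑ H : Fin n → Sym q s → Bool, weight ε H * ∑ v, Fintype.card (Word q s n) *
      ‖badPart d (preimageProd H b) v‖ ^ 2 * ‖codeState (C : Set (Word q s n)) v‖ ^ 2 =
    ∑ H : Fin n → Sym q s → Bool, weight ε H * ∑ v, ‖badPart d (preimageProd H b) v‖ ^ 2 := by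
  have hshift : ∀ v : Word q s n,
      ∑ H : Fin n → Sym q s → Bool, weight ε H * ‖badPart d (preimageProd H b) v‖ ^ 2 =
      ∑ H : Fin n → Sym q s → Bool, weight ε H * ‖badPart d (preimageProd H b) 0‖ ^ 2 := by
    intro v
    rw [← sum_weight_comp_add ε (fun H => ‖badPart d (preimageProd H b) 0‖ ^ 2) v]
    simp only [preimageProd_comp_add, badPart_comp_add, zero_add]
  simp only [Finset.mul_sum]
  rw [Finset.sum_comm, Finset.sum_comm (s := Finset.univ) (t := Finset.univ)
    (f := fun H v => weight ε H * ‖badPart d (preimageProd H b) v‖ ^ 2)]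
  simp only [hshift]
  rw [Finset.sum_const, Finset.card_univ, nsmul_eq_mul]
  have h2 : ∀ v, ∑ H : Fin n → Sym q s → Bool, weight ε H * (Fintype.card (Word q s n) *
      ‖badPart d (preimageProd H b) v‖ ^ 2 * ‖codeState (C : Set (Word q s n)) v‖ ^ 2) =
      ‖codeState (C : Set (Word q s n)) v‖ ^ 2 * (Fintype.card (Word q s n) *
        ∑ H : Fin n → Sym q s → Bool, weight ε H * ‖badPart d (preimageProd H b) 0‖ ^ 2) := by
    intro v
    rw [← hshift v, Finset.mul_sum, Finset.mul_sum]
    exact Finset.sum_congr rfl fun H _ => by ring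
  simp only [h2]
  rw [← Finset.sum_mul, sum_norm_sq_codeState, one_mul]

lemma sum_weight_preimages_empty_le {ε : ℝ} (h0 : 0 < ε) (h1 : ε ≤ 1 / 2) (i : Fin n) (b : Bool) :
    ∑ H : Fin n → Sym q s → Bool with ¬ (preimages H i b).Nonempty, weight ε H ≤
      (ε * Fintype.card (Sym q s))⁻¹ := by
  have hS : (0 : ℝ) < Fintype.card (Sym q s) := Nat.cast_pos.mpr Fintype.card_pos
  refine (sum_weight_le_pow h0.le h1 ({i} ×ˢ Finset.univ) _ (fun _ _ => !b) ?_).trans ?_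
  · intro H hH p hp
    simp only [Finset.mem_filter, Finset.mem_univ, true_and, preimages,
      Finset.not_nonempty_iff_eq_empty, Finset.filter_eq_empty_iff] at hH
    simp only [Finset.mem_product, Finset.mem_singleton, Finset.mem_univ, and_true] at hp
    have := @hH p.2 trivial
    rw [hp]
    cases h : H i p.2 <;> cases b <;> simp_all
  · rw [Finset.card_product, Finset.card_singleton, one_mul, Finset.card_univ]
    calc (1 - ε) ^ Fintype.card (Sym q s) ≤ Real.exp (-ε) ^ Fintype.card (Sym q s) :=
          pow_le_pow_left₀ (by linarith) (Real.one_sub_le_exp_neg ε) _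
      _ = (Real.exp (ε * Fintype.card (Sym q s)))⁻¹ := by
          rw [← Real.exp_nat_mul, ← Real.exp_neg]; congr 1; ring
      _ ≤ _ := by
          refine inv_anti₀ (by positivity) ?_
          linarith [Real.add_one_le_exp (ε * Fintype.card (Sym q s))]

end Average

section Dual

variable {q : ℕ} [hq : Fact q.Prime]

open Polynomial in
/-- The multiplicity code as a subgroup. -/
def multCodeSubgroup {n : ℕ} (s : ℕ) (α : Fin n → ZMod q) (k : ℕ) : AddSubgroup (Word q s n) where
  carrier := multCodeAt s α k
  zero_mem' := ⟨0, Submodule.zero_mem _, fun i j => by simp⟩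
  add_mem' := by
    rintro c c' ⟨f, hf, hc⟩ ⟨f', hf', hc'⟩
    exact ⟨f + f', Submodule.add_mem _ hf hf', fun i j => by simp [hc, hc']⟩
  neg_mem' := by
    rintro c ⟨f, hf, hc⟩
    exact ⟨-f, Submodule.neg_mem _ hf, fun i j => by simp [hc]⟩

open Polynomial in
/-- The dual distance: the blocks at `d - 1` points, with `d * s ≤ k`, are independent. -/
lemma hasDistance_dualCode_multCodeAt {n s k d : ℕ} {α : Fin n → ZMod q}
    (hα : Function.Injective α) (hd : d * s ≤ k) : HasDistance (dualCode (multCodeAt s α k)) d := by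
  classical
  intro c₁ h₁ c₂ h₂ hne
  by_contra! hlt
  set z := c₁ - c₂ with hz
  have hz0 : z ≠ 0 := sub_ne_zero.mpr hne
  have hdual : ∀ c ∈ multCodeAt s α k, dot z c = 0 := fun c hc => by
    rw [hz, dot_sub_left, h₁ c hc, h₂ c hc, sub_zero]
  obtain ⟨i₀, hi₀⟩ := Function.ne_iff.mp hz0
  -- `j₀` is the last nonzero entry of the block at `i₀`.
  have hJ : (Finset.univ.filter fun j => z i₀ j ≠ 0).Nonempty := by
    obtain ⟨j, hj⟩ := Function.ne_iff.mp hi₀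
    exact ⟨j, by simpa using hj⟩
  set j₀ := (Finset.univ.filter fun j => z i₀ j ≠ 0).max' hJ with hj₀
  have hj₀z : z i₀ j₀ ≠ 0 := by
    have := Finset.max'_mem _ hJ
    rw [← hj₀] at this
    simpa using this
  have hj₀max : ∀ j, j₀ < j → z i₀ j = 0 := by
    intro j hj
    by_contra hcon
    exact absurd (Finset.le_max' _ j (by simpa using hcon)) (not_le.mpr hj)
  set U : Finset (Fin n) := (Finset.univ.filter fun i => z i ≠ 0).erase i₀ with hU
  have hi₀U : i₀ ∈ (Finset.univ.filter fun i => z i ≠ 0) := by simpa using hi₀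
  have hUcard : U.card + 1 < d := by
    rw [hU, Finset.card_erase_add_one hi₀U]
    exact hlt
  -- This polynomial vanishes to order `s` at the other points of the support, and to order exactly
  -- `j₀` at `α i₀`.
  set g : (ZMod q)[X] := ∏ i ∈ U, (X - C (α i)) ^ s with hg
  set f : (ZMod q)[X] := g * (X - C (α i₀)) ^ (j₀ : ℕ) with hf
  have hgmonic : g.Monic := monic_prod_of_monic _ _ fun i _ => (monic_X_sub_C _).pow _
  have hfmonic : f.Monic := hgmonic.mul ((monic_X_sub_C _).pow _)
  have hdeg : f.natDegree < k := by
    have h1 : g.natDegree = U.card * s := by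
      rw [hg, natDegree_prod_of_monic _ _ fun i _ => (monic_X_sub_C _).pow _]
      simp
    rw [hf, hgmonic.natDegree_mul ((monic_X_sub_C _).pow _), h1, natDegree_pow, natDegree_X_sub_C,
      mul_one]
    have h2 : (U.card + 1) * s ≤ d * s := Nat.mul_le_mul_right _ hUcard.le
    rw [add_mul, one_mul] at h2
    have := j₀.2
    omega
  set c : Word q s n := fun i j => (hasseDeriv (j : ℕ) f).eval (α i) with hc
  have hcC : c ∈ multCodeAt s α k := by
    refine ⟨f, mem_degreeLT.mpr ?_, fun i j => rfl⟩
    exact (natDegree_lt_iff_degree_lt hfmonic.ne_zero).mp hdeg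
  have hvan : ∀ i ∈ U, ∀ j : Fin s, c i j = 0 := by
    intro i hi j
    refine X_sub_C_pow_dvd_iff_hasseDeriv.mp ?_ j j.2
    exact (Finset.dvd_prod_of_mem (fun i => (X - C (α i)) ^ s) hi).mul_right _
  have hvan₀ : ∀ j : Fin s, j < j₀ → c i₀ j = 0 := fun j hj =>
    X_sub_C_pow_dvd_iff_hasseDeriv.mp (Dvd.intro_left g rfl) j hj
  have hc₀ : c i₀ j₀ ≠ 0 := by
    intro h0
    have hdvd : (X - C (α i₀)) ^ ((j₀ : ℕ) + 1) ∣ f := by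
      refine X_sub_C_pow_dvd_iff_hasseDeriv.mpr fun j hj => ?_
      rcases Nat.lt_succ_iff_lt_or_eq.mp hj with h | h
      · exact hvan₀ ⟨j, h.trans j₀.2⟩ h
      · rw [h]; exact h0
    rw [pow_succ', hf] at hdvd
    have := (mul_dvd_mul_iff_right (pow_ne_zero _ (X_sub_C_ne_zero (α i₀)))).mp hdvd
    rw [hg, (prime_X_sub_C (α i₀)).dvd_finsetProd_iff] at this
    obtain ⟨i, hi, hdi⟩ := this
    have h1 := (prime_X_sub_C (α i₀)).dvd_of_dvd_pow hdi
    rw [dvd_iff_isRoot, IsRoot, eval_sub, eval_X, eval_C, sub_eq_zero] at h1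
    exact (Finset.ne_of_mem_erase hi) (hα h1).symm
  have hdot := hdual c hcC
  rw [dot, Finset.sum_eq_single i₀, Finset.sum_eq_single j₀] at hdot
  · exact mul_ne_zero hj₀z hc₀ hdot
  · intro j _ hj
    rcases lt_or_gt_of_ne hj with h | h
    · rw [hvan₀ j h, mul_zero]
    · rw [hj₀max j h, zero_mul]
  · simp
  · intro i _ hi
    refine Finset.sum_eq_zero fun j _ => ?_
    by_cases hzi : z i = 0
    · rw [hzi]; simp
    · rw [hvan i (by simp [hU, hi, hzi]) j, mul_zero]
  · simp

lemma evalPoints_injective :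
    Function.Injective fun i : Fin q => (((i : ℕ) + 1 : ℕ) : ZMod q) := by
  intro i j h
  simp only [Nat.cast_add, Nat.cast_one, add_left_inj] at h
  have h2 := (ZMod.natCast_eq_natCast_iff' _ _ _).mp h
  rw [Nat.mod_eq_of_lt i.2, Nat.mod_eq_of_lt j.2] at h2
  exact Fin.ext h2

end Dual

section GoodProbability

lemma prod_four_sub_bern_le {ε : ℝ} (h0 : 0 ≤ ε) {l q : ℕ} (x : Fin l → Bool) (h1 : ε ≤ 1) :
    ∏ i, (4 - 3 * bern ε (padZero q x i)) ≤ 4 ^ l * (1 + 3 * ε) ^ q := by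
  calc ∏ i, (4 - 3 * bern ε (padZero q x i))
      ≤ ∏ i : Fin q, (if (i : ℕ) < l then 4 else 1) * (1 + 3 * ε) := by
        refine Finset.prod_le_prod (fun i _ => ?_) fun i _ => ?_
        · cases padZero q x i
          · simp only [bern, Bool.false_eq_true, if_false]; linarith
          · simp only [bern, if_true]; linarith
        · by_cases hi : (i : ℕ) < l
          · have := bern_nonneg h0 h1 (padZero q x i)
            rw [if_pos hi]
            linarith
          · simp only [padZero, hi, dif_neg, not_false_iff, if_false, bern, Bool.false_eq_true]
            linarith
    _ ≤ 4 ^ l * (1 + 3 * ε) ^ q := by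
        rw [Finset.prod_mul_distrib, Finset.prod_const, Finset.card_univ, Fintype.card_fin]
        refine mul_le_mul_of_nonneg_right ?_ (by positivity)
        rw [← Finset.prod_filter, Finset.prod_const]
        refine pow_le_pow_right₀ (by norm_num) ?_
        calc _ ≤ (Finset.range l).card := Finset.card_le_card_of_injOn (fun i : Fin q => (i : ℕ))
              (fun i hi => by simpa using hi) Fin.val_injective.injOn
          _ = l := Finset.card_range l

open Classical in
/-- With bias `1 / l ^ 4` a random function is good with probability at least `1 / 2`: the expected
number of errors is `O(l)`, and the decoder corrects almost `l ^ 2 / 2` of them. -/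
theorem half_le_weight_good {l q : ℕ} [hq : Fact q.Prime] (hl : 13 ≤ l) (hlq : l ^ 5 < q)
    (hql : q ≤ 2 * l ^ 5) {Dec : Word q l q → Word q l q}
    (hDec : IsUniqueDecoder (dualCode (code l q)) Dec) :
    1 / 2 ≤ ∑ H : Fin q → Sym q l → Bool with H ∈ Good l q Dec, weight (1 / (l : ℝ) ^ 4) H := by
  set ε : ℝ := 1 / (l : ℝ) ^ 4 with hε
  have hl' : (13 : ℝ) ≤ l := by exact_mod_cast hl
  have hl0 : (0 : ℝ) < l := by linarith
  have hε0 : 0 < ε := by positivity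
  have hε1 : ε ≤ 1 / 2 := by
    rw [hε]
    refine one_div_le_one_div_of_le (by norm_num) ?_
    calc (2 : ℝ) ≤ l := by linarith
      _ ≤ (l : ℝ) ^ 4 := le_self_pow₀ (by linarith) (by norm_num)
  set C : AddSubgroup (Word q l q) :=
    multCodeSubgroup l (fun i : Fin q => (((i : ℕ) + 1 : ℕ) : ZMod q)) (l ^ 3) with hC
  have hCcode : (C : Set (Word q l q)) = code l q := rfl
  have hd : HasDistance (dualCode (C : Set (Word q l q))) (l ^ 2) :=
    hasDistance_dualCode_multCodeAt evalPoints_injective (by rw [← pow_succ])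
  let X : (Fin l → Bool) → (Fin q → Sym q l → Bool) → ℝ := fun x H =>
    ∑ v, ‖badPart (l ^ 2) (preimageProd H (padZero q x)) v‖ ^ 2 +
      ∑ v, Fintype.card (Word q l q) * ‖badPart (l ^ 2) (preimageProd H (padZero q x)) v‖ ^ 2 *
        ‖codeState (C : Set (Word q l q)) v‖ ^ 2
  have hX0 : ∀ x H, 0 ≤ X x H := fun x H => by positivity
  have hw0 : ∀ H : Fin q → Sym q l → Bool, 0 ≤ weight ε H :=
    weight_nonneg hε0.le (by linarith)
  -- Union bound and Markov's inequality.
  have hpt : ∀ H : Fin q → Sym q l → Bool, weight ε H ≤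
      (if H ∈ Good l q Dec then weight ε H else 0) +
      ∑ i, ∑ b, (if ¬ (preimages H i b).Nonempty then weight ε H else 0) +
      ∑ x, 6 * (weight ε H * X x H) := by
    intro H
    have hn2 : 0 ≤ ∑ i, ∑ b, (if ¬ (preimages H i b).Nonempty then weight ε H else 0) :=
      Finset.sum_nonneg fun i _ => Finset.sum_nonneg fun b _ => by
        split_ifs
        · exact le_rfl
        · exact hw0 H
    have hn3 : 0 ≤ ∑ x, 6 * (weight ε H * X x H) :=
      Finset.sum_nonneg fun x _ => mul_nonneg (by norm_num) (mul_nonneg (hw0 H) (hX0 x H))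
    by_cases hG : H ∈ Good l q Dec
    · rw [if_pos hG]; linarith
    rw [if_neg hG, zero_add]
    by_cases hne : ∀ i b, (preimages H i b).Nonempty
    · simp only [Good, Set.mem_ofPred_eq, not_forall, not_le] at hG
      obtain ⟨x, hx⟩ := hG
      have h1 := le_yzSuccess hd hDec (padZero q x) hne
      have h2 : 1 / 6 ≤ X x H := by
        rw [hCcode] at h1
        simp only [X, hCcode]
        linarith
      have h3 : 6 * (weight ε H * X x H) ≤ ∑ x, 6 * (weight ε H * X x H) :=
        Finset.single_le_sum (f := fun x => 6 * (weight ε H * X x H)) (fun x _ =>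
          mul_nonneg (by norm_num) (mul_nonneg (hw0 H) (hX0 x H))) (Finset.mem_univ x)
      nlinarith [hw0 H]
    · push Not at hne
      obtain ⟨i, b, hib⟩ := hne
      have h1 : weight ε H ≤
          ∑ i, ∑ b, (if ¬ (preimages H i b).Nonempty then weight ε H else 0) := by
        have h2 : ∀ i b, 0 ≤ if ¬ (preimages H i b).Nonempty then weight ε H else 0 := by
          intro i b
          split_ifs
          · exact le_rfl
          · exact hw0 H
        calc weight ε H = if ¬ (preimages H i b).Nonempty then weight ε H else 0 := by
              rw [if_pos (by rw [hib]; exact Finset.not_nonempty_empty)]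
          _ ≤ ∑ b, (if ¬ (preimages H i b).Nonempty then weight ε H else 0) :=
              Finset.single_le_sum (fun b _ => h2 i b) (Finset.mem_univ b)
          _ ≤ _ := Finset.single_le_sum (f := fun i => ∑ b, (if ¬ (preimages H i b).Nonempty then
              weight ε H else 0)) (fun i _ => Finset.sum_nonneg fun b _ => h2 i b)
              (Finset.mem_univ i)
      linarith
  have hsum := Finset.sum_le_sum fun H (_ : H ∈ Finset.univ) => hpt H
  rw [sum_weight, Finset.sum_add_distrib, Finset.sum_add_distrib, ← Finset.sum_filter] at hsum
  have hempty : ∑ H : Fin q → Sym q l → Bool, ∑ i, ∑ b,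
      (if ¬ (preimages H i b).Nonempty then weight ε H else 0) ≤ 1 / 4 := by
    rw [Finset.sum_comm]
    have h1 : ∀ i : Fin q, ∑ H : Fin q → Sym q l → Bool, ∑ b,
        (if ¬ (preimages H i b).Nonempty then weight ε H else 0) ≤
        2 * (ε * Fintype.card (Sym q l))⁻¹ := by
      intro i
      rw [Finset.sum_comm]
      refine (Finset.sum_le_card_nsmul _ _ (ε * Fintype.card (Sym q l))⁻¹ fun b _ => ?_).trans
        (le_of_eq (by simp))
      rw [← Finset.sum_filter]
      exact sum_weight_preimages_empty_le hε0 hε1 i b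
    refine (Finset.sum_le_card_nsmul _ _ _ fun i _ => h1 i).trans ?_
    have hcard : (Fintype.card (Sym q l) : ℝ) = (q : ℝ) ^ l := by
      rw [Fintype.card_fun, Fintype.card_fin, ZMod.card, Nat.cast_pow]
    rw [Finset.card_univ, Fintype.card_fin, nsmul_eq_mul, hcard]
    have hqR : (l : ℝ) ^ 5 < q := by exact_mod_cast hlq
    have h8 : 8 * (l : ℝ) ^ 4 ≤ q := by nlinarith [pow_pos hl0 4]
    have hq0 : (0 : ℝ) < q := lt_of_lt_of_le (by positivity) h8
    have hq1 : (1 : ℝ) ≤ q := by exact_mod_cast hq.out.one_lt.le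
    have hqq : (q : ℝ) * q ≤ (q : ℝ) ^ l := by
      rw [← sq]
      exact pow_le_pow_right₀ hq1 (by omega)
    have hkey : 8 * (l : ℝ) ^ 4 * q ≤ (q : ℝ) ^ l :=
      (mul_le_mul_of_nonneg_right h8 hq0.le).trans hqq
    have : (q : ℝ) * (2 * (ε * (q : ℝ) ^ l)⁻¹) = 2 * (l : ℝ) ^ 4 * q / (q : ℝ) ^ l := by
      rw [hε]; field_simp
    rw [this, div_le_iff₀ (by positivity)]
    linarith
  have hbad : ∑ H : Fin q → Sym q l → Bool, ∑ x, 6 * (weight ε H * X x H) ≤ 1 / 4 := by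
    rw [Finset.sum_comm]
    have h1 : ∀ x, ∑ H : Fin q → Sym q l → Bool, 6 * (weight ε H * X x H) ≤
        6 * (2 * (((2 : ℝ) ^ (l ^ 2))⁻¹ * (4 ^ l * (1 + 3 * ε) ^ q))) := by
      intro x
      rw [← Finset.mul_sum]
      refine mul_le_mul_of_nonneg_left ?_ (by norm_num)
      simp only [X, mul_add, Finset.sum_add_distrib]
      rw [sum_weight_mul_badPart_mul_codeState]
      have h2 := sum_weight_mul_badPart_le (q := q) (s := l) hε0.le (by linarith) (l ^ 2)
        (padZero q x)
      have h3 := mul_le_mul_of_nonneg_left (prod_four_sub_bern_le hε0.le (q := q) x (by linarith))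
        (show (0 : ℝ) ≤ ((2 : ℝ) ^ (l ^ 2))⁻¹ by positivity)
      linarith
    refine (Finset.sum_le_card_nsmul _ _ _ fun x _ => h1 x).trans ?_
    rw [Finset.card_univ, Fintype.card_fun, Fintype.card_fin, Fintype.card_bool, nsmul_eq_mul,
      Nat.cast_pow, Nat.cast_ofNat]
    have hexp : (1 + 3 * ε) ^ q ≤ (2 : ℝ) ^ (9 * l) := by
      calc (1 + 3 * ε) ^ q ≤ Real.exp (3 * ε) ^ q :=
            pow_le_pow_left₀ (by positivity) (by linarith [Real.add_one_le_exp (3 * ε)]) _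
        _ = Real.exp (q * (3 * ε)) := (Real.exp_nat_mul _ _).symm
        _ ≤ Real.exp (l * 6) := by
            refine Real.exp_le_exp.mpr ?_
            have hqR : (q : ℝ) ≤ 2 * (l : ℝ) ^ 5 := by exact_mod_cast hql
            calc (q : ℝ) * (3 * ε) ≤ 2 * (l : ℝ) ^ 5 * (3 * ε) :=
                  mul_le_mul_of_nonneg_right hqR (by positivity)
              _ = l * 6 := by rw [hε]; field_simp; ring
        _ = Real.exp 6 ^ l := Real.exp_nat_mul _ _
        _ ≤ ((2 : ℝ) ^ 9) ^ l := by
            refine pow_le_pow_left₀ (Real.exp_pos _).le ?_ _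
            have : Real.exp 6 = Real.exp 1 ^ 6 := by rw [← Real.exp_nat_mul]; norm_num
            rw [this]
            calc Real.exp 1 ^ 6 ≤ (2.72 : ℝ) ^ 6 :=
                  pow_le_pow_left₀ (Real.exp_pos _).le (by linarith [Real.exp_one_lt_d9]) _
              _ ≤ (2 : ℝ) ^ 9 := by norm_num
        _ = (2 : ℝ) ^ (9 * l) := (pow_mul _ _ _).symm
    have h4 : (4 : ℝ) ^ l = 2 ^ (2 * l) := by rw [pow_mul]; norm_num
    calc (2 : ℝ) ^ l * (6 * (2 * (((2 : ℝ) ^ (l ^ 2))⁻¹ * (4 ^ l * (1 + 3 * ε) ^ q))))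
        ≤ (2 : ℝ) ^ l * (6 * (2 * (((2 : ℝ) ^ (l ^ 2))⁻¹ * (4 ^ l * 2 ^ (9 * l))))) := by gcongr
      _ = 12 * 2 ^ (12 * l) / (2 : ℝ) ^ (l ^ 2) := by
          have h12 : (2 : ℝ) ^ (12 * l) = 2 ^ l * (2 ^ (2 * l) * 2 ^ (9 * l)) := by
            rw [← pow_add, ← pow_add]; congr 1; ring
          rw [h4, h12]
          field_simp
          ring
      _ ≤ 1 / 4 := by
          rw [div_le_iff₀ (by positivity)]
          have h13 : (2 : ℝ) ^ (12 * l + 13) ≤ 2 ^ (l ^ 2) :=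
            pow_le_pow_right₀ (by norm_num) (by nlinarith)
          rw [pow_add] at h13
          have : (0 : ℝ) < 2 ^ (12 * l) := by positivity
          nlinarith
  linarith

end GoodProbability

/-! ### The hybrid method for quantum query algorithms -/

namespace QueryAlgorithm

variable {D : Type} [Fintype D] {t Q : ℕ}

section Norm

variable {B : Type*} [Fintype B]

/-- The Euclidean norm of a state. -/
def stateNorm (ψ : B → ℂ) : ℝ := ‖WithLp.toLp 2 ψ‖

lemma stateNorm_sq (ψ : B → ℂ) : stateNorm ψ ^ 2 = ∑ z, ‖ψ z‖ ^ 2 := by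
  rw [stateNorm, EuclideanSpace.norm_sq_eq]

lemma stateNorm_nonneg (ψ : B → ℂ) : 0 ≤ stateNorm ψ := norm_nonneg _

lemma stateNorm_add_le (ψ φ : B → ℂ) : stateNorm (ψ + φ) ≤ stateNorm ψ + stateNorm φ := by
  rw [stateNorm, WithLp.toLp_add]
  exact norm_add_le _ _

lemma stateNorm_le_of_sq_le {ψ : B → ℂ} {r : ℝ} (hr : 0 ≤ r) (h : ∑ z, ‖ψ z‖ ^ 2 ≤ r ^ 2) :
    stateNorm ψ ≤ r := by
  rw [← stateNorm_sq] at h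
  exact (sq_le_sq₀ (stateNorm_nonneg _) hr).mp h

lemma stateNorm_eq_of_sum_eq {B' : Type*} [Fintype B'] {ψ : B → ℂ} {φ : B' → ℂ}
    (h : ∑ z, ‖ψ z‖ ^ 2 = ∑ z, ‖φ z‖ ^ 2) : stateNorm ψ = stateNorm φ := by
  rw [← stateNorm_sq, ← stateNorm_sq] at h
  exact (sq_eq_sq₀ (stateNorm_nonneg _) (stateNorm_nonneg _)).mp h

lemma stateNorm_mulVec [DecidableEq B] (U : Matrix.unitaryGroup B ℂ) (ψ : B → ℂ) :
    stateNorm ((U : Matrix B B ℂ).mulVec ψ) = stateNorm ψ := by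
  refine stateNorm_eq_of_sum_eq ?_
  have h : ∀ φ : B → ℂ, ((∑ z, ‖φ z‖ ^ 2 : ℝ) : ℂ) = star φ ⬝ᵥ φ := by
    intro φ
    simp only [dotProduct, Pi.star_apply, RCLike.star_def, Complex.conj_mul', Complex.ofReal_sum,
      Complex.ofReal_pow]
  have hU : (U : Matrix B B ℂ).conjTranspose * (U : Matrix B B ℂ) = 1 :=
    Matrix.mem_unitaryGroup_iff'.mp U.2
  rw [← Complex.ofReal_inj, h, h, Matrix.star_mulVec, Matrix.dotProduct_mulVec,
    Matrix.vecMul_vecMul, hU, Matrix.vecMul_one]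

end Norm

lemma sum_queryGate_comp {pad anc : ℕ} (f : D → Bool) (F : QBasis D t pad anc → ℝ) :
    ∑ z : QBasis D t pad anc,
      F (z.1, xor z.2.1 (Sum.elim f (fun _ => false) z.1), z.2.2) = ∑ z, F z := by
  have hinv : Function.Involutive fun z : QBasis D t pad anc =>
      ((z.1, xor z.2.1 (Sum.elim f (fun _ => false) z.1), z.2.2) : QBasis D t pad anc) := by
    intro z
    simp
  exact Fintype.sum_equiv hinv.toPerm _ _ fun z => rfl

/-- The squared norm of the part of `ψ` which queries a point where `f` and `g` differ. -/
def diffMass {pad anc : ℕ} (f g : D → Bool) (ψ : QBasis D t pad anc → ℂ) : ℝ :=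
  ∑ z : QBasis D t pad anc, if Sum.elim f (fun _ => false) z.1 ≠ Sum.elim g (fun _ => false) z.1
    then ‖ψ z‖ ^ 2 else 0

lemma diffMass_nonneg {pad anc : ℕ} (f g : D → Bool) (ψ : QBasis D t pad anc → ℂ) :
    0 ≤ diffMass f g ψ :=
  Finset.sum_nonneg fun z _ => by split_ifs <;> positivity

lemma stateNorm_queryGate {pad anc : ℕ} (f : D → Bool) (ψ : QBasis D t pad anc → ℂ) :
    stateNorm (queryGate f ψ) = stateNorm ψ :=
  stateNorm_eq_of_sum_eq (sum_queryGate_comp f fun z => ‖ψ z‖ ^ 2)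

lemma stateNorm_queryGate_sub_le {pad anc : ℕ} (f g : D → Bool) (ψ : QBasis D t pad anc → ℂ) :
    stateNorm (queryGate g ψ - queryGate f ψ) ≤ 2 * Real.sqrt (diffMass f g ψ) := by
  refine stateNorm_le_of_sq_le (by positivity) ?_
  rw [mul_pow, Real.sq_sqrt (diffMass_nonneg f g ψ)]
  let F : QBasis D t pad anc → ℝ := fun z =>
    if Sum.elim f (fun _ => false) z.1 ≠ Sum.elim g (fun _ => false) z.1 then ‖ψ z‖ ^ 2 else 0
  have h1 : ∀ z : QBasis D t pad anc, ‖(queryGate g ψ - queryGate f ψ) z‖ ^ 2 ≤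
      2 * F (z.1, xor z.2.1 (Sum.elim g (fun _ => false) z.1), z.2.2) +
      2 * F (z.1, xor z.2.1 (Sum.elim f (fun _ => false) z.1), z.2.2) := by
    intro z
    simp only [F, Pi.sub_apply, queryGate]
    by_cases h : Sum.elim f (fun _ => false) z.1 = Sum.elim g (fun _ => false) z.1
    · simp [h]
    · rw [if_pos h, if_pos h]
      have hsq : ∀ x y : ℂ, ‖x - y‖ ^ 2 ≤ 2 * ‖x‖ ^ 2 + 2 * ‖y‖ ^ 2 := fun x y => by
        nlinarith [norm_sub_le x y, norm_nonneg (x - y), sq_nonneg (‖x‖ - ‖y‖), norm_nonneg x,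
          norm_nonneg y]
      exact hsq _ _
  refine (Finset.sum_le_sum fun z _ => h1 z).trans (le_of_eq ?_)
  rw [Finset.sum_add_distrib, ← Finset.mul_sum, ← Finset.mul_sum, sum_queryGate_comp,
    sum_queryGate_comp, diffMass]
  ring

variable [DecidableEq D] (A : QueryAlgorithm D t Q)

lemma stateAt_zero (f : D → Bool) (w : Fin t → Bool) :
    A.stateAt f w 0 = (A.unitary 0 : Matrix _ _ ℂ).mulVec (A.initState w) := rfl

lemma stateAt_succ (f : D → Bool) (w : Fin t → Bool) (i : Fin Q) :
    A.stateAt f w i.succ = (A.unitary i.succ : Matrix _ _ ℂ).mulVec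
      (queryGate f (A.stateAt f w i.castSucc)) := rfl

lemma stateNorm_stateAt (f : D → Bool) (w : Fin t → Bool) (i : Fin (Q + 1)) :
    stateNorm (A.stateAt f w i) = 1 := by
  induction i using Fin.induction with
  | zero =>
    rw [stateAt_zero, stateNorm_mulVec, stateNorm, initState]
    exact (PiLp.norm_single 2 _ _ _).trans (by simp)
  | succ i ih => rw [stateAt_succ, stateNorm_mulVec, stateNorm_queryGate, ih]

lemma stateNorm_stateAt_sub_le (f g : D → Bool) (w : Fin t → Bool) (i : Fin (Q + 1)) :
    stateNorm (A.stateAt g w i - A.stateAt f w i) ≤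
      ∑ j : Fin Q with j.castSucc < i, 2 * Real.sqrt (diffMass f g (A.stateAt f w j.castSucc)) := by
  induction i using Fin.induction with
  | zero =>
    rw [stateAt_zero, stateAt_zero, sub_self]
    simp [stateNorm]
  | succ i ih =>
    have hfilter : (Finset.univ.filter fun j : Fin Q => j.castSucc < i.succ) =
        insert i (Finset.univ.filter fun j : Fin Q => j.castSucc < i.castSucc) := by
      ext j
      simp only [Finset.mem_filter, Finset.mem_univ, true_and, Finset.mem_insert, Fin.lt_def,
        Fin.ext_iff, Fin.val_castSucc, Fin.val_succ]
      omega
    rw [hfilter, Finset.sum_insert (by simp), stateAt_succ, stateAt_succ, ← Matrix.mulVec_sub,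
      stateNorm_mulVec]
    have hsplit : queryGate g (A.stateAt g w i.castSucc) - queryGate f (A.stateAt f w i.castSucc) =
        (queryGate g (A.stateAt f w i.castSucc) - queryGate f (A.stateAt f w i.castSucc)) +
          queryGate g (A.stateAt g w i.castSucc - A.stateAt f w i.castSucc) := by
      funext z
      simp only [Pi.sub_apply, Pi.add_apply, queryGate]
      ring
    rw [hsplit]
    refine (stateNorm_add_le _ _).trans (add_le_add (stateNorm_queryGate_sub_le f g _) ?_)
    rw [stateNorm_queryGate]
    exact ih

lemma acceptProb_sub_le (f g : D → Bool) (w : Fin t → Bool) :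
    A.acceptProb g w - A.acceptProb f w ≤
      2 * stateNorm (A.stateAt g w (Fin.last Q) - A.stateAt f w (Fin.last Q)) := by
  set ψ := A.stateAt g w (Fin.last Q) with hψ
  set φ := A.stateAt f w (Fin.last Q) with hφ
  let R : (QBasis D t A.pad A.anc → ℂ) → QBasis D t A.pad A.anc → ℂ :=
    fun χ z => if A.accept z then χ z else 0
  have hR : ∀ χ, stateNorm (R χ) ^ 2 = ∑ z, if A.accept z then ‖χ z‖ ^ 2 else 0 := by
    intro χ
    rw [stateNorm_sq]
    refine Finset.sum_congr rfl fun z _ => ?_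
    simp only [R]
    split_ifs <;> simp
  have hRle : ∀ χ, stateNorm (R χ) ≤ stateNorm χ := by
    intro χ
    refine stateNorm_le_of_sq_le (stateNorm_nonneg _) ?_
    rw [stateNorm_sq]
    refine Finset.sum_le_sum fun z _ => ?_
    simp only [R]
    split_ifs <;> simp
  have h1 : stateNorm (R ψ) ≤ stateNorm (ψ - φ) + stateNorm (R φ) := by
    have hsum : R ψ = R (ψ - φ) + R φ := by
      funext z
      simp only [R, Pi.add_apply, Pi.sub_apply]
      split_ifs <;> simp
    rw [hsum]
    exact (stateNorm_add_le _ _).trans (add_le_add (hRle _) le_rfl)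
  have h2 : stateNorm (R ψ) ≤ 1 := (hRle ψ).trans (stateNorm_stateAt A g w _).le
  have h3 : stateNorm (R φ) ≤ 1 := (hRle φ).trans (stateNorm_stateAt A f w _).le
  rw [acceptProb, acceptProb, ← hψ, ← hφ, ← hR, ← hR]
  nlinarith [stateNorm_nonneg (R ψ), stateNorm_nonneg (R φ), stateNorm_nonneg (ψ - φ)]

/-- The total weight with which the algorithm queries the point `p`. -/
def queryMass (f : D → Bool) (w : Fin t → Bool) (p : D) : ℝ :=
  ∑ i : Fin Q, ∑ r, ‖A.stateAt f w i.castSucc (Sum.inl p, r)‖ ^ 2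

lemma queryMass_nonneg (f : D → Bool) (w : Fin t → Bool) (p : D) : 0 ≤ A.queryMass f w p :=
  Finset.sum_nonneg fun _ _ => Finset.sum_nonneg fun _ _ => by positivity

lemma sum_queryMass_le (f : D → Bool) (w : Fin t → Bool) : ∑ p, A.queryMass f w p ≤ Q := by
  simp only [queryMass]
  rw [Finset.sum_comm]
  refine (Finset.sum_le_card_nsmul _ _ 1 fun i _ => ?_).trans (le_of_eq (by simp))
  have h1 : ∑ z, ‖A.stateAt f w i.castSucc z‖ ^ 2 = 1 := by
    rw [← stateNorm_sq, stateNorm_stateAt, one_pow]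
  rw [Fintype.sum_prod_type, Fintype.sum_sum_type] at h1
  have h2 : 0 ≤ ∑ x : Fin A.pad, ∑ r, ‖A.stateAt f w i.castSucc (Sum.inr x, r)‖ ^ 2 := by positivity
  linarith

/-- The hybrid bound: replacing `f` by `g` one query at a time moves the final state by at most
twice the sum of the norms of the parts that query a difference, and the Cauchy–Schwarz inequality turns
these norms into query weights. -/
theorem le_sum_queryMass_of_acceptProb {f g : D → Bool} {w : Fin t → Bool}
    (h : 1 / 3 ≤ A.acceptProb g w - A.acceptProb f w) :
    1 / 144 ≤ Q * ∑ p with f p ≠ g p, A.queryMass f w p := by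
  have h1 := (acceptProb_sub_le A f g w).trans
    (mul_le_mul_of_nonneg_left (stateNorm_stateAt_sub_le A f g w (Fin.last Q)) (by norm_num))
  rw [← Finset.mul_sum, Finset.filter_true_of_mem fun j _ => Fin.castSucc_lt_last j] at h1
  set m : Fin Q → ℝ := fun j => diffMass f g (A.stateAt f w j.castSucc) with hm
  have hm0 : ∀ j, 0 ≤ m j := fun j => diffMass_nonneg _ _ _
  have h2 : 1 / 12 ≤ ∑ j, Real.sqrt (m j) := by linarith
  have h3 : (∑ j, Real.sqrt (m j)) ^ 2 ≤ Q * ∑ j, m j := by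
    have := sq_sum_le_card_mul_sum_sq (s := (Finset.univ : Finset (Fin Q)))
      (f := fun j => Real.sqrt (m j))
    simpa only [Real.sq_sqrt (hm0 _), Finset.card_univ, Fintype.card_fin] using this
  have h4 : ∑ j, m j = ∑ p with f p ≠ g p, A.queryMass f w p := by
    simp only [queryMass]
    rw [Finset.sum_comm]
    refine Finset.sum_congr rfl fun j _ => ?_
    simp only [hm, diffMass]
    rw [Fintype.sum_prod_type, Fintype.sum_sum_type, Finset.sum_filter]
    have h5 : ∀ x : Fin A.pad, ∑ r, (if Sum.elim f (fun _ => false) (Sum.inr x : D ⊕ Fin A.pad) ≠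
        Sum.elim g (fun _ => false) (Sum.inr x) then
        ‖A.stateAt f w j.castSucc (Sum.inr x, r)‖ ^ 2 else 0) = 0 :=
      fun x => Finset.sum_eq_zero fun r _ => if_neg (not_not.mpr rfl)
    rw [Finset.sum_eq_zero (s := Finset.univ) fun x _ => h5 x, add_zero]
    refine Finset.sum_congr rfl fun p _ => ?_
    by_cases hp : f p = g p
    · rw [if_neg (not_not.mpr hp)]
      exact Finset.sum_eq_zero fun r _ => if_neg (not_not.mpr hp)
    · rw [if_pos hp]
      exact Finset.sum_congr rfl fun r _ => if_pos hp
  rw [← h4]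
  nlinarith

end QueryAlgorithm

/-! ### Extracting valid pairs from a verifier -/

section Extraction

variable {l q t Q : ℕ} [hq : Fact q.Prime]

lemma padZero_injective {l q : ℕ} (hlq : l ≤ q) :
    Function.Injective (padZero q : (Fin l → Bool) → _) := by
  intro x y h
  funext i
  have := congrFun h ⟨i, i.2.trans_le hlq⟩
  simpa [padZero] using this

/-- The pair `p` lies in the code intersection relation, after padding. -/
def Valid {l q : ℕ} (H : Fin q → Sym q l → Bool) (p : OracleDomain l q) : Prop :=
  (padZero q p.1, p.2) ∈ codeRel (code l q) H

open Classical in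
lemma oracle_eq_of_valid {l q : ℕ} {H : Fin q → Sym q l → Bool} {E : Finset (OracleDomain l q)}
    (hE : ∀ p ∈ E, Valid H p) : oracle l q H E = fun p => decide (p ∈ E) := by
  funext p
  simp only [oracle, Finset.mem_coe, decide_eq_decide]
  exact ⟨fun h => h.2, fun h => ⟨hE p h, h⟩⟩

open Classical in
/-- One extraction step. The verifier tells the oracle with all pairs from the one that only knows
the pairs in `E`, and its run with the latter does not depend on `H`. Hence some new pair, which is
queried with the latter oracle, is valid for a noticeable part of the functions. -/
lemma exists_valid_pair {W : (Fin q → Sym q l → Bool) → ℝ} (hW : ∀ H, 0 ≤ W H)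
    (A : QueryAlgorithm (OracleDomain l q) t Q) (w : Fin t → Bool)
    (E : Finset (OracleDomain l q)) (𝓗 : Finset (Fin q → Sym q l → Bool))
    (hpos : 0 < ∑ H ∈ 𝓗, W H) (hE : ∀ H ∈ 𝓗, ∀ p ∈ E, Valid H p)
    (hacc : ∀ H ∈ 𝓗, 2 / 3 ≤ A.acceptProb (oracle l q H Set.univ) w)
    (hrej : ∀ H ∈ 𝓗, A.acceptProb (oracle l q H E) w ≤ 1 / 3) :
    ∃ p ∉ E, (288 * (Q : ℝ) ^ 2)⁻¹ * ∑ H ∈ 𝓗, W H ≤ ∑ H ∈ 𝓗 with Valid H p, W H := by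
  by_contra! hcon
  set f : OracleDomain l q → Bool := fun p => decide (p ∈ E) with hf
  set μ := A.queryMass f w with hμ
  have hμ0 : ∀ p, 0 ≤ μ p := A.queryMass_nonneg f w
  have h1 : ∀ H ∈ 𝓗, 1 / 144 ≤ Q * ∑ p with p ∉ E, if Valid H p then μ p else 0 := by
    intro H hH
    have h2 := hrej H hH
    rw [oracle_eq_of_valid (hE H hH)] at h2
    have h3 := A.le_sum_queryMass_of_acceptProb (f := f) (g := oracle l q H Set.univ) (w := w)
      (by linarith [hacc H hH])
    refine h3.trans (mul_le_mul_of_nonneg_left (le_of_eq ?_) (Nat.cast_nonneg _))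
    rw [← Finset.sum_filter, Finset.filter_filter]
    refine Finset.sum_congr (Finset.filter_congr fun p _ => ?_) fun _ _ => rfl
    have hg : oracle l q H Set.univ p = decide (Valid H p) := by
      rw [oracle, decide_eq_decide]
      exact and_iff_left trivial
    rw [hf, hg, Ne, decide_eq_decide]
    constructor
    · intro h
      have hpE : p ∉ E := fun hp => h ⟨fun _ => hE H hH p hp, fun _ => hp⟩
      exact ⟨hpE, by_contra fun hv => h ⟨fun hp => absurd hp hpE, fun hv' => absurd hv' hv⟩⟩
    · rintro ⟨hpE, hv⟩ h
      exact hpE (h.mpr hv)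
  have h2 : (1 / 144) * ∑ H ∈ 𝓗, W H ≤ Q * ∑ p with p ∉ E, μ p * ∑ H ∈ 𝓗 with Valid H p, W H := by
    calc (1 / 144) * ∑ H ∈ 𝓗, W H = ∑ H ∈ 𝓗, (1 / 144) * W H := by rw [Finset.mul_sum]
      _ ≤ ∑ H ∈ 𝓗, (Q * ∑ p with p ∉ E, if Valid H p then μ p else 0) * W H :=
        Finset.sum_le_sum fun H hH => mul_le_mul_of_nonneg_right (h1 H hH) (hW H)
      _ = Q * ∑ p with p ∉ E, μ p * ∑ H ∈ 𝓗 with Valid H p, W H := by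
        simp only [mul_assoc]
        rw [← Finset.mul_sum]
        simp only [Finset.sum_mul, Finset.mul_sum, Finset.sum_filter _ (s := 𝓗)]
        rw [Finset.sum_comm]
        simp only [ite_mul, zero_mul, mul_ite, mul_zero]
  have h3 : ∑ p with p ∉ E, μ p * ∑ H ∈ 𝓗 with Valid H p, W H ≤
      Q * ((288 * (Q : ℝ) ^ 2)⁻¹ * ∑ H ∈ 𝓗, W H) := by
    calc _ ≤ ∑ p with p ∉ E, μ p * ((288 * (Q : ℝ) ^ 2)⁻¹ * ∑ H ∈ 𝓗, W H) :=
          Finset.sum_le_sum fun p hp => mul_le_mul_of_nonneg_left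
            (hcon p (Finset.mem_filter.mp hp).2).le (hμ0 p)
      _ = (∑ p with p ∉ E, μ p) * ((288 * (Q : ℝ) ^ 2)⁻¹ * ∑ H ∈ 𝓗, W H) := by
          rw [Finset.sum_mul]
      _ ≤ _ := by
          refine mul_le_mul_of_nonneg_right ?_ (by positivity)
          exact (Finset.sum_le_sum_of_subset_of_nonneg (Finset.filter_subset _ _)
            fun p _ _ => hμ0 p).trans (A.sum_queryMass_le f w)
  have h4 := h2.trans (mul_le_mul_of_nonneg_left h3 (Nat.cast_nonneg Q))
  have h5 : (Q : ℝ) * (Q * ((288 * (Q : ℝ) ^ 2)⁻¹ * ∑ H ∈ 𝓗, W H)) ≤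
      1 / 288 * ∑ H ∈ 𝓗, W H := by
    rcases Nat.eq_zero_or_pos Q with h | h
    · subst h
      simp only [Nat.cast_zero, zero_mul]
      positivity
    · have : (Q : ℝ) ≠ 0 := by positivity
      refine le_of_eq ?_
      field_simp
  linarith

open Classical in
/-- Iterating the extraction step yields `j` valid pairs, at the price of a factor `O(Q ^ 2)` in
probability for each of them. -/
lemma exists_valid_pairs {W : (Fin q → Sym q l → Bool) → ℝ} (hW : ∀ H, 0 ≤ W H) (hQ : 0 < Q)
    (A : QueryAlgorithm (OracleDomain l q) t Q) (w : Fin t → Bool)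
    (𝓗₀ : Finset (Fin q → Sym q l → Bool)) (hpos : 0 < ∑ H ∈ 𝓗₀, W H)
    (hacc : ∀ H ∈ 𝓗₀, 2 / 3 ≤ A.acceptProb (oracle l q H Set.univ) w)
    (hrej : ∀ H ∈ 𝓗₀, ∀ E : Set (OracleDomain l q), (∃ F : Finset (Fin l → Bool),
      (F.card : ℝ) ≤ 2 ^ l / 3 ∧ E ⊆ (F : Set (Fin l → Bool)) ×ˢ Set.univ) →
      A.acceptProb (oracle l q H E) w ≤ 1 / 3) (j : ℕ) (hj : 3 * j ≤ 2 ^ l) :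
    ∃ E : Finset (OracleDomain l q), E.card = j ∧ ∃ 𝓗 ⊆ 𝓗₀, (∀ H ∈ 𝓗, ∀ p ∈ E, Valid H p) ∧
      (288 * (Q : ℝ) ^ 2)⁻¹ ^ j * ∑ H ∈ 𝓗₀, W H ≤ ∑ H ∈ 𝓗, W H := by
  induction j with
  | zero => exact ⟨∅, rfl, 𝓗₀, subset_rfl, by simp, by simp⟩
  | succ j ih =>
    obtain ⟨E, hEj, 𝓗, h𝓗, hE, hle⟩ := ih (by omega)
    have hp : 0 < (288 * (Q : ℝ) ^ 2)⁻¹ := by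
      have : (0 : ℝ) < Q := Nat.cast_pos.mpr hQ
      positivity
    have hF : ∃ F : Finset (Fin l → Bool), (F.card : ℝ) ≤ 2 ^ l / 3 ∧
        (E : Set (OracleDomain l q)) ⊆ (F : Set (Fin l → Bool)) ×ˢ Set.univ := by
      refine ⟨E.image Prod.fst, ?_, fun p hp =>
        ⟨Finset.mem_coe.mpr (Finset.mem_image_of_mem _ hp), trivial⟩⟩
      rw [le_div_iff₀ (by norm_num)]
      have h1 : (E.image Prod.fst).card * 3 ≤ 2 ^ l :=
        (Nat.mul_le_mul_right 3 (Finset.card_image_le.trans hEj.le)).trans (by omega)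
      exact_mod_cast h1
    obtain ⟨p, hpE, hpv⟩ := exists_valid_pair hW A w E 𝓗 (lt_of_lt_of_le (by positivity) hle) hE
      (fun H hH => hacc H (h𝓗 hH)) fun H hH => hrej H (h𝓗 hH) E hF
    refine ⟨insert p E, by rw [Finset.card_insert_of_notMem hpE, hEj],
      𝓗.filter fun H => Valid H p, (Finset.filter_subset _ _).trans h𝓗, ?_, ?_⟩
    · intro H hH p' hp'
      rw [Finset.mem_filter] at hH
      rcases Finset.mem_insert.mp hp' with rfl | h
      · exact hH.2
      · exact hE H hH.1 p' h
    · refine le_trans ?_ hpv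
      rw [pow_succ', mul_assoc]
      exact mul_le_mul_of_nonneg_left hle hp.le

/-- By expansion, many pairs are simultaneously valid only with tiny probability. -/
lemma sum_weight_le_of_valid {ε : ℝ} (h0 : 0 ≤ ε) (h1 : ε ≤ 1 / 2) (hlq : l ≤ q) {m B : ℕ}
    (hm : m ≤ l) (hB : 0 < B) (hk : l ^ 3 ≤ q) (hBq : 2 * B + l ^ 3 * m ≤ q)
    {E : Finset (OracleDomain l q)} (hcard : E.card = 2 ^ m)
    {𝓗 : Finset (Fin q → Sym q l → Bool)} (hE : ∀ H ∈ 𝓗, ∀ p ∈ E, Valid H p) :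
    ∑ H ∈ 𝓗, weight ε H ≤ (1 - ε) ^ (B * 2 ^ m) := by
  classical
  rcases 𝓗.eq_empty_or_nonempty with rfl | ⟨H₀, hH₀⟩
  · rw [Finset.sum_empty]
    exact pow_nonneg (by linarith) _
  set V : Finset (Word q l q) := E.image Prod.snd with hV
  have hVcard : V.card = 2 ^ m := by
    rw [hV, Finset.card_image_of_injOn, hcard]
    intro p hp p' hp' h
    have h2 := (hE H₀ hH₀ p hp).2
    have h3 := (hE H₀ hH₀ p' hp').2
    refine Prod.ext (padZero_injective hlq (funext fun i => ?_)) h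
    simp only at h2 h3 h
    rw [← h2 i, ← h3 i, h]
  have hVC : (V : Set (Word q l q)) ⊆ code l q := by
    intro v hv
    obtain ⟨p, hp, rfl⟩ := Finset.mem_image.mp (Finset.mem_coe.mp hv)
    exact (hE H₀ hH₀ p hp).1
  have hexp := le_sum_card_image_of_subset_multCodeAt (evalPoints_injective (q := q)) hm hk hB hBq V
    hVC hVcard
  let T : Finset (Fin q × Sym q l) :=
    (Finset.univ.sigma fun i => V.image fun v => v i).map
      (Equiv.sigmaEquivProd (Fin q) (Sym q l)).toEmbedding
  have hT : B * 2 ^ m ≤ T.card := by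
    rw [Finset.card_map, Finset.card_sigma]
    exact hexp
  refine (sum_weight_le_pow h0 h1 T 𝓗 H₀ ?_).trans
    (pow_le_pow_of_le_one (by linarith) (by linarith) hT)
  rintro H hH ⟨i, e⟩ hp
  obtain ⟨⟨i', e'⟩, hmem, hie⟩ := Finset.mem_map.mp hp
  obtain ⟨rfl, rfl⟩ := Prod.ext_iff.mp hie
  simp only [Finset.mem_sigma, Finset.mem_univ, true_and] at hmem
  obtain ⟨v, hv, rfl⟩ := Finset.mem_image.mp hmem
  obtain ⟨p, hpE, rfl⟩ := Finset.mem_image.mp hv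
  exact ((hE H hH p hpE).2 i').trans ((hE H₀ hH₀ p hpE).2 i').symm

end Extraction

/-- Polynomial growth of `Q` and `t` enters only through these inequalities. -/
lemma eventually_param_bounds (a : ℝ) (Q t : ℕ → ℕ)
    (hQ : ∀ᶠ l : ℕ in atTop, (Q l : ℝ) ≤ a * (l : ℝ) ^ a)
    (ht : ∀ᶠ l : ℕ in atTop, (t l : ℝ) ≤ a * (l : ℝ) ^ a) :
    ∀ᶠ l : ℕ in atTop, 16 ≤ l ∧ t l + 1 ≤ 2 ^ (l - 2) ∧
      576 * (Q l : ℝ) ^ 2 < Real.exp ((l / 4 : ℕ) : ℝ) := by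
  have h1 : (fun x : ℝ => a * x ^ a) =o[atTop] fun x => Real.exp (1 / 32 * x) :=
    (isLittleO_rpow_exp_pos_mul_atTop a (by norm_num)).const_mul_left a
  have h2 := tendsto_natCast_atTop_atTop (R := ℝ) |>.eventually
    (h1.bound (show (0 : ℝ) < 1 / 100 by norm_num))
  filter_upwards [hQ, ht, h2, eventually_ge_atTop 16] with l hQl htl h2l hl
  rw [Real.norm_eq_abs, Real.norm_of_nonneg (Real.exp_pos _).le] at h2l
  have h3 : a * (l : ℝ) ^ a ≤ 1 / 100 * Real.exp (1 / 32 * l) := (le_abs_self _).trans h2l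
  have hl' : (16 : ℝ) ≤ l := by exact_mod_cast hl
  refine ⟨hl, ?_, ?_⟩
  · have h4 : (1 : ℝ) ≤ Real.exp (1 / 32 * l) := Real.one_le_exp (by positivity)
    have h5 : 8 ≤ Real.exp (15 / 32 * l) := by
      have := Real.add_one_le_exp (15 / 32 * (l : ℝ))
      linarith
    have h6 : Real.exp (1 / 2 * l) ≤ 2 ^ l := by
      rw [mul_comm, Real.exp_nat_mul]
      refine pow_le_pow_left₀ (Real.exp_pos _).le ?_ l
      have h7 : Real.exp (1 / 2) ^ 2 ≤ 2 ^ 2 := by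
        rw [← Real.exp_nat_mul]
        norm_num
        linarith [Real.exp_one_lt_d9]
      exact (sq_le_sq₀ (Real.exp_pos _).le (by norm_num)).mp h7
    have h8 : Real.exp (1 / 2 * l) = Real.exp (1 / 32 * l) * Real.exp (15 / 32 * l) := by
      rw [← Real.exp_add]; congr 1; ring
    have h9 : (2 : ℝ) ^ l = 4 * 2 ^ (l - 2) := by
      rw [show (4 : ℝ) = 2 ^ 2 by norm_num, ← pow_add, Nat.add_sub_cancel' (by omega)]
    have h10 : (t l : ℝ) + 1 ≤ 2 ^ (l - 2) := by nlinarith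
    exact_mod_cast h10
  · have h4 : (l : ℝ) / 16 ≤ ((l / 4 : ℕ) : ℝ) := by
      have : l ≤ 16 * (l / 4) := by omega
      have : (l : ℝ) ≤ 16 * ((l / 4 : ℕ) : ℝ) := by exact_mod_cast this
      linarith
    have h5 : (Q l : ℝ) ≤ 1 / 100 * Real.exp (1 / 32 * l) := hQl.trans h3
    have h6 : (Q l : ℝ) ^ 2 ≤ (1 / 100 * Real.exp (1 / 32 * l)) ^ 2 :=
      pow_le_pow_left₀ (Nat.cast_nonneg _) h5 2
    have h7 : Real.exp (1 / 32 * (l : ℝ)) ^ 2 = Real.exp ((l : ℝ) / 16) := by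
      rw [← Real.exp_nat_mul]; congr 1; push_cast; ring
    rw [mul_pow, h7] at h6
    have h8 := Real.exp_le_exp.mpr h4
    have h9 := Real.exp_pos ((l : ℝ) / 16)
    linarith

end CodeIntersection

end

open CodeIntersection in
theorem mainTheorem3 (a : ℝ) (ha : 0 < a) (Q t : ℕ → ℕ)
    (hQ : ∀ᶠ l : ℕ in atTop, (Q l : ℝ) ≤ a * (l : ℝ) ^ a)
    (ht : ∀ᶠ l : ℕ in atTop, (t l : ℝ) ≤ a * (l : ℝ) ^ a) :
    ∀ᶠ l : ℕ in atTop, ∀ (q : ℕ) [Fact q.Prime], l ^ 5 < q → q ≤ 2 * l ^ 5 →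
      ∀ Dec : Word q l q → Word q l q, IsUniqueDecoder (dualCode (code l q)) Dec →
      ∀ A : QueryAlgorithm (OracleDomain l q) (t l) (Q l),
      ∃ H ∈ Good l q Dec, ∃ E : Set (OracleDomain l q),
        (E = Set.univ ∧
          ∀ w : Fin (t l) → Bool, A.acceptProb (oracle l q H E) w < 2 / 3) ∨
        ((∃ F : Finset (Fin l → Bool), (F.card : ℝ) ≤ 2 ^ l / 3 ∧
            E ⊆ (F : Set (Fin l → Bool)) ×ˢ Set.univ) ∧
          ∃ w : Fin (t l) → Bool, 1 / 3 < A.acceptProb (oracle l q H E) w) := by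
  filter_upwards [eventually_param_bounds a Q t hQ ht] with l hl q hq hlq hql Dec hDec A
  obtain ⟨hl16, htl, hQl⟩ := hl
  classical
  by_contra! hcon
  have hacc : ∀ H ∈ Good l q Dec, ∃ w, 2 / 3 ≤ A.acceptProb (oracle l q H Set.univ) w :=
    fun H hH => (hcon H hH Set.univ).1 rfl
  have hrej : ∀ H ∈ Good l q Dec, ∀ E : Set (OracleDomain l q), (∃ F : Finset (Fin l → Bool),
      (F.card : ℝ) ≤ 2 ^ l / 3 ∧ E ⊆ (F : Set (Fin l → Bool)) ×ˢ Set.univ) →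
      ∀ w, A.acceptProb (oracle l q H E) w ≤ 1 / 3 :=
    fun H hH E hE w => (hcon H hH E).2 hE w
  have hl0 : (0 : ℝ) < l := by positivity
  set ε : ℝ := 1 / (l : ℝ) ^ 4 with hε
  have hε0 : 0 < ε := by positivity
  have hε1 : ε ≤ 1 / 2 := by
    rw [hε]
    refine one_div_le_one_div_of_le (by norm_num) ?_
    have : (2 : ℝ) ≤ l := by exact_mod_cast (by omega : 2 ≤ l)
    exact this.trans (le_self_pow₀ (by linarith) (by norm_num))
  have hw0 : ∀ H : Fin q → Sym q l → Bool, 0 ≤ weight ε H :=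
    weight_nonneg hε0.le (by linarith)
  -- The most popular witness is accepted for at least a fraction `2 ^ (-t)` of the good functions.
  obtain ⟨w, hw⟩ : ∃ w : Fin (t l) → Bool, ((2 : ℝ) ^ (t l + 1))⁻¹ ≤
      ∑ H : Fin q → Sym q l → Bool with
        H ∈ Good l q Dec ∧ 2 / 3 ≤ A.acceptProb (oracle l q H Set.univ) w, weight ε H := by
    by_contra! hlt
    have h1 : ∑ H : Fin q → Sym q l → Bool with H ∈ Good l q Dec, weight ε H ≤
        ∑ w : Fin (t l) → Bool, ∑ H : Fin q → Sym q l → Bool with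
          H ∈ Good l q Dec ∧ 2 / 3 ≤ A.acceptProb (oracle l q H Set.univ) w, weight ε H := by
      simp only [Finset.sum_filter]
      rw [Finset.sum_comm]
      refine Finset.sum_le_sum fun H _ => ?_
      have h0 : ∀ w, 0 ≤ if H ∈ Good l q Dec ∧
          2 / 3 ≤ A.acceptProb (oracle l q H Set.univ) w then weight ε H else 0 := by
        intro w
        split_ifs
        · exact hw0 H
        · exact le_rfl
      by_cases hG : H ∈ Good l q Dec
      · obtain ⟨w, hw⟩ := hacc H hG
        rw [if_pos hG]
        refine le_trans (le_of_eq ?_) (Finset.single_le_sum (fun w _ => h0 w) (Finset.mem_univ w))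
        rw [if_pos ⟨hG, hw⟩]
      · rw [if_neg hG]
        exact Finset.sum_nonneg fun w _ => h0 w
    have h2 := Finset.sum_lt_sum_of_nonempty (Finset.univ_nonempty (α := Fin (t l) → Bool))
      fun w _ => hlt w
    rw [Finset.sum_const, Finset.card_univ, Fintype.card_fun, Fintype.card_fin, Fintype.card_bool,
      nsmul_eq_mul, Nat.cast_pow, Nat.cast_ofNat] at h2
    have h3 : (2 : ℝ) ^ t l * (2 ^ (t l + 1))⁻¹ = 1 / 2 := by
      rw [pow_succ]; field_simp
    rw [h3] at h2
    linarith [half_le_weight_good (by omega) hlq hql hDec]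
  set 𝓗₀ : Finset (Fin q → Sym q l → Bool) := Finset.univ.filter fun H =>
    H ∈ Good l q Dec ∧ 2 / 3 ≤ A.acceptProb (oracle l q H Set.univ) w with h𝓗₀
  have hpos : 0 < ∑ H ∈ 𝓗₀, weight ε H := lt_of_lt_of_le (by positivity) hw
  -- Without queries the verifier could not tell the two kinds of oracles apart.
  have hQ0 : 0 < Q l := by
    obtain ⟨H, hH⟩ : 𝓗₀.Nonempty := by
      by_contra hne
      rw [Finset.not_nonempty_iff_eq_empty] at hne
      rw [hne, Finset.sum_empty] at hpos
      exact lt_irrefl _ hpos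
    obtain ⟨hG, hw2⟩ := (Finset.mem_filter.mp hH).2
    have h1 := hrej H hG ∅ ⟨∅, by simp; positivity, Set.empty_subset _⟩ w
    have h2 := A.le_sum_queryMass_of_acceptProb (f := oracle l q H ∅)
      (g := oracle l q H Set.univ) (w := w) (by linarith)
    by_contra hQ0
    have hQz : (Q l : ℝ) = 0 := by exact_mod_cast Nat.eq_zero_of_not_pos hQ0
    rw [hQz, zero_mul] at h2
    norm_num at h2
  have h2l : 4 * 2 ^ (l - 2) = 2 ^ l := by
    rw [show 4 = 2 ^ 2 by norm_num, ← pow_add, Nat.add_sub_cancel' (by omega)]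
  obtain ⟨E, hEcard, 𝓗, h𝓗, hE, hle⟩ := exists_valid_pairs hw0 hQ0 A w 𝓗₀ hpos
    (fun H hH => (Finset.mem_filter.mp hH).2.2)
    (fun H hH E hEF => hrej H (Finset.mem_filter.mp hH).2.1 E hEF w) (2 ^ (l - 2)) (by omega)
  -- The expansion constant is `l ^ 4 * r`, a constant fraction of `q`, so that with bias
  -- `1 / l ^ 4` every one of the `K` codewords contributes a factor `exp (-r)`.
  set r := l / 4 with hr
  have hr0 : 0 < r := by omega
  have hl3 : l ^ 3 ≤ l ^ 5 := Nat.pow_le_pow_right (by omega) (by norm_num)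
  have hl1 : l ≤ l ^ 5 := Nat.le_self_pow (by norm_num) l
  have hsize : 2 * (l ^ 4 * r) + l ^ 3 * (l - 2) ≤ q := by
    have h1 : l ^ 3 * (l - 2) ≤ l ^ 4 := by
      rw [pow_succ l 3]
      exact Nat.mul_le_mul_left _ (Nat.sub_le _ _)
    have h2 : l ^ 4 * (2 * r + 1) ≤ l ^ 4 * l := Nat.mul_le_mul_left _ (by omega)
    calc 2 * (l ^ 4 * r) + l ^ 3 * (l - 2) ≤ 2 * (l ^ 4 * r) + l ^ 4 := by gcongr
      _ = l ^ 4 * (2 * r + 1) := by ring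
      _ ≤ l ^ 4 * l := h2
      _ = l ^ 5 := (pow_succ l 4).symm
      _ ≤ q := hlq.le
  have hup := sum_weight_le_of_valid hε0.le hε1 (by omega) (Nat.sub_le l 2)
    (Nat.mul_pos (pow_pos (by omega) 4) hr0) (by omega) hsize hEcard hE
  set K := 2 ^ (l - 2) with hK
  have hK0 : K ≠ 0 := by positivity
  have hexp : (1 - ε) ^ (l ^ 4 * r * K) ≤ (Real.exp r ^ K)⁻¹ := by
    calc (1 - ε) ^ (l ^ 4 * r * K) ≤ Real.exp (-ε) ^ (l ^ 4 * r * K) :=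
          pow_le_pow_left₀ (by linarith) (Real.one_sub_le_exp_neg ε) _
      _ = (Real.exp r ^ K)⁻¹ := by
          rw [← Real.exp_nat_mul, ← Real.exp_nat_mul, ← Real.exp_neg]
          congr 1
          push_cast
          rw [hε]
          field_simp
  have hQR : (0 : ℝ) < Q l := Nat.cast_pos.mpr hQ0
  have hlow : ((576 * (Q l : ℝ) ^ 2) ^ K)⁻¹ ≤
      (288 * (Q l : ℝ) ^ 2)⁻¹ ^ K * ∑ H ∈ 𝓗₀, weight ε H := by
    calc ((576 * (Q l : ℝ) ^ 2) ^ K)⁻¹ = (288 * (Q l : ℝ) ^ 2)⁻¹ ^ K * (2 ^ K)⁻¹ := by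
          rw [inv_pow, ← mul_inv, ← mul_pow]; congr 2; ring
      _ ≤ (288 * (Q l : ℝ) ^ 2)⁻¹ ^ K * (2 ^ (t l + 1))⁻¹ :=
          mul_le_mul_of_nonneg_left (inv_anti₀ (by positivity)
            (pow_le_pow_right₀ (by norm_num) htl)) (by positivity)
      _ ≤ _ := mul_le_mul_of_nonneg_left hw (by positivity)
  -- The `K`-th powers beat both the losses of the extraction and the `2 ^ (t + 1)`, as `t < K`.
  have hfin := hlow.trans (hle.trans (hup.trans hexp))
  rw [inv_le_inv₀ (by positivity) (by positivity)] at hfin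
  exact absurd hfin (not_le.mpr (pow_lt_pow_left₀ hQl (by positivity) hK0))
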